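/- Let $E$ be a reflexive real Banach space and let $M$ be a regular Hausdorff $C^1$ manifold (without boundary) modelled on $E$; the case $M=E$ is included. For $\psi:M\to\mathbb R$ and $q\in M$, the Fréchet subdifferential $\partial_F\psi(q)\subset T_q^*M$ is the set of all differentials $dg_q$ of $C^1$ functions $g:M\to\mathbb R$ such that $\psi-g$ has a local minimum at $q$. The limiting subdifferential $\partial_L\psi(q)\subset T_q^*M$ is the set of all $\zeta$ for which there are $q_k\to q$ with $\psi(q_k)\to\psi(q)$ and $\zeta_k\in\partial_F\psi(q_k)$ with $\zeta_k\rightharpoonup\zeta$, where weak convergence means weak convergence in $E^*$ of the coordinate expressions of the $\zeta_k$ in charts around $q$. Let $\ell:M\to\mathbb R$ be locally Lipschitz (that is, locally Lipschitz in local coordinates), let $q\in M$, and let $V\subset T_qM$ be closed, bounded and convex. For $v\in V$ and a coordinate chart $\varphi$ around $q$, the set-constrained weak lower Dini derivative of $\ell$ at $q$ in direction $v$ is $$D^w_V\ell(q;v):=\inf\ \lim_{n\to\infty}\frac{\ell\bigl(\varphi^{-1}(\varphi(q)+\lambda_n\,d\varphi_q v_n)\bigr)-\ell(q)}{\lambda_n},$$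 the infimum being over all sequences $v_n\in V$ that converge weakly to $v$ and all $\lambda_n>0$ with $\lambda_n\to0$ for which the limit exists in $[-\infty,\infty]$. Then, for every chart $\varphi$ around $q$ used to compute $D^w_V\ell(q;\cdot)$ and every $r\in\mathbb R$ with $D^w_V\ell(q;v)\ge r$ for all $v\in V$, there exists $\zeta\in\partial_L\ell(q)$ such that $\langle\zeta,v\rangle\ge r$ for all $v\in V$. -/

import Mathlib

open Filter Topology
open scoped Manifold ContDiff

noncomputable section

/-- A real normed space is reflexive if the canonical isometry into its bidual is onto. -/
def IsReflexiveSpace (E : Type*) [NormedAddCommGroup E] [NormedSpace ℝ E] : Prop :=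
  Function.Surjective (NormedSpace.inclusionInDoubleDual ℝ E)

section Manifold

variable {E : Type*} [NormedAddCommGroup E] [NormedSpace ℝ E]
  {M : Type*} [TopologicalSpace M] [ChartedSpace E M]

/-- `φ` is a (`C¹`-compatible) coordinate chart of `M` whose domain contains `q`. -/
def IsChartAround (φ : OpenPartialHomeomorph M E) (q : M) : Prop :=
  φ ∈ IsManifold.maximalAtlas 𝓘(ℝ, E) 1 M ∧ q ∈ φ.source

/-- `ℓ` is locally Lipschitz on the manifold `M`: every point has a chart in which `ℓ` is
Lipschitz, of some rank, near that point. -/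
def IsLocallyLipschitzOnManifold (ℓ : M → ℝ) : Prop :=
  ∀ p : M, ∃ φ : OpenPartialHomeomorph M E, IsChartAround φ p ∧
    ∃ K : NNReal, ∃ U ∈ 𝓝 (φ p), LipschitzOnWith K (ℓ ∘ φ.symm) U

/-- The Fréchet subdifferential of `ψ` at `q`: the differentials `dg_q` of the
`C¹` functions `g` on `M` such that `ψ - g` has a local minimum at `q`. -/
def frechetSubdifferential (ψ : M → ℝ) (q : M) : Set (TangentSpace 𝓘(ℝ, E) q →L[ℝ] ℝ) :=
  {ζ | ∃ g : M → ℝ, ContMDiff 𝓘(ℝ, E) 𝓘(ℝ, ℝ) 1 g ∧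
    IsLocalMin (fun p => ψ p - g p) q ∧ mvfderiv 𝓘(ℝ, E) g q = ζ}

/-- Weak convergence `ζ_k ⇀ ζ` of covectors `ζ_k ∈ T*_{q_k}M` to `ζ ∈ T*_qM` (where `q_k → q`):
in every chart `φ` around `q`, the coordinate expressions `ζ_k ∘ (dφ_{q_k})⁻¹` converge to
`ζ ∘ (dφ_q)⁻¹` pointwise on `E`, i.e. weak-* in the dual of `E`, which for reflexive `E` is weak
convergence. (As `q_k → q`, all but finitely many `q_k` are in the domain of `φ`.) -/
def CovectorsTendstoWeakly (p : ℕ → M) (ζs : ∀ k, TangentSpace 𝓘(ℝ, E) (p k) →L[ℝ] ℝ)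
    (q : M) (ζ : TangentSpace 𝓘(ℝ, E) q →L[ℝ] ℝ) : Prop :=
  ∀ φ : OpenPartialHomeomorph M E, IsChartAround φ q → ∀ w : E,
    Tendsto (fun k => ζs k ((mvfderiv 𝓘(ℝ, E) φ (p k)).inverse w)) atTop
      (𝓝 (ζ ((mvfderiv 𝓘(ℝ, E) φ q).inverse w)))

/-- The limiting subdifferential of `ψ` at `q`. -/
def limitingSubdifferential (ψ : M → ℝ) (q : M) : Set (TangentSpace 𝓘(ℝ, E) q →L[ℝ] ℝ) :=
  {ζ | ∃ (p : ℕ → M) (ζs : ∀ k, TangentSpace 𝓘(ℝ, E) (p k) →L[ℝ] ℝ),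
    Tendsto p atTop (𝓝 q) ∧ Tendsto (fun k => ψ (p k)) atTop (𝓝 (ψ q)) ∧
    (∀ k, ζs k ∈ frechetSubdifferential ψ (p k)) ∧ CovectorsTendstoWeakly p ζs q ζ}

/-- The set-constrained weak lower Dini derivative `D^w_V ℓ(q; v)`, computed in the chart `φ`:
the infimum of the limits (in the extended reals, whenever they exist) of the difference quotients
`(ℓ(φ⁻¹(φ(q) + λ_n dφ_q v_n)) - ℓ(q)) / λ_n` over sequences `v_n ∈ V` that converge weakly to `v`
and `λ_n ↓ 0`. -/
def weakLowerDini (φ : OpenPartialHomeomorph M E) (ℓ : M → ℝ) (q : M)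
    (V : Set (TangentSpace 𝓘(ℝ, E) q)) (v : TangentSpace 𝓘(ℝ, E) q) : EReal :=
  sInf {L : EReal | ∃ (vs : ℕ → TangentSpace 𝓘(ℝ, E) q) (t : ℕ → ℝ),
    (∀ n, vs n ∈ V) ∧
    (∀ ξ : TangentSpace 𝓘(ℝ, E) q →L[ℝ] ℝ, Tendsto (fun n => ξ (vs n)) atTop (𝓝 (ξ v))) ∧
    (∀ n, 0 < t n) ∧ Tendsto t atTop (𝓝 0) ∧
    Tendsto (fun n => (((ℓ (φ.symm (φ q + t n • mvfderiv 𝓘(ℝ, E) φ q (vs n)))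
      - ℓ q) / t n : ℝ) : EReal)) atTop (𝓝 L)}

end Manifold

end

/-!
A smooth substitute for the norm drives the proof. A reflexive space carries a total family of
functionals `F γ` with `(F γ x)_γ` in `c₀` for every `x` (Lindenstrauss), obtained by transfinite
induction along a chain of norm-one projections. Such a family yields a penalty on the dual unit
ball that is weak-* lower semicontinuous and strictly convex in a sense strong enough that its
minimizers tilted by `x` depend continuously on `x`. The conjugate of the penalty is therefore
a convex `C¹` gauge `θ`, comparable with the norm away from the origin.

Read in a chart, the lower bound on the weak lower Dini derivatives is, by weak sequential
compactness of `V`, a growth condition for small times that is uniform in the direction. Take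
a Lipschitz function `ψ` with such growth along a bounded closed convex set `W`, and minimize
`ψ z + K θ (x₀ + t w - z) - t r` over `z`, `t ∈ [0, T]` and `w ∈ W`. The minimum over the weakly
compact cone is attained, and attainment in `z` costs a small `C¹` perturbation, by the smooth
variational principle. The growth forces `t < T`, so that moving along the cone shows that the
derivative of the penalty is at least `r` on `W`, while stationarity in `z` makes this derivative,
up to a small error, a Fréchet subgradient of `ψ` at `z`. Weak limits of such subgradients as
`T → 0` give the required limiting subgradient.
-/

/-! ### Separation of subspaces and weak sequential limits -/

section Separation

variable {E : Type*} [NormedAddCommGroup E] [NormedSpace ℝ E]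

theorem exists_dual_eq_zero_of_notMem {A : Submodule ℝ E} (hA : IsClosed (A : Set E)) {x : E}
    (hx : x ∉ A) : ∃ f : StrongDual ℝ E, (∀ a ∈ A, f a = 0) ∧ f x ≠ 0 := by
  obtain ⟨f, u, hu, hux⟩ := geometric_hahn_banach_closed_point A.convex hA hx
  have hf : ∀ a ∈ A, f a = 0 := by
    intro a ha
    by_contra h
    have := hu _ (A.smul_mem ((u + 1) / f a) ha)
    rw [map_smul, smul_eq_mul, div_mul_cancel₀ _ h] at this
    linarith
  have hu_neg := hu 0 A.zero_mem
  rw [map_zero] at hu_neg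
  exact ⟨f, hf, (hu_neg.trans hux).ne'⟩

theorem eq_top_of_dual_eq_zero {A : Submodule ℝ E} (hA : IsClosed (A : Set E))
    (h : ∀ f : StrongDual ℝ E, (∀ a ∈ A, f a = 0) → f = 0) : A = ⊤ := by
  refine Submodule.eq_top_iff'.2 fun x => ?_
  by_contra hx
  obtain ⟨f, hf, hfx⟩ := exists_dual_eq_zero_of_notMem hA hx
  exact hfx (by rw [h f hf, zero_apply])

theorem mem_of_isClosed_of_convex_of_tendsto_dual {ι : Type*} {l : Filter ι} [l.NeBot]
    {s : Set E} (hs : IsClosed s) (hconv : Convex ℝ s) {v : ι → E} {x : E}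
    (hv : ∀ᶠ i in l, v i ∈ s)
    (hx : ∀ f : StrongDual ℝ E, Tendsto (fun i => f (v i)) l (𝓝 (f x))) : x ∈ s := by
  by_contra hxs
  obtain ⟨f, u, hu, hux⟩ := geometric_hahn_banach_closed_point hconv hs hxs
  exact hux.not_ge (le_of_tendsto (hx f) (hv.mono fun i hi => (hu _ hi).le))

theorem exists_subseq_tendsto_on_closure {A : Set E} (hA : A.Countable) {u : ℕ → StrongDual ℝ E}
    {R : ℝ} (hu : ∀ n, ‖u n‖ ≤ R) :
    ∃ f : StrongDual ℝ E, ∃ κ : ℕ → ℕ, StrictMono κ ∧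
      ∀ x ∈ closure A, Tendsto (fun n => u (κ n) x) atTop (𝓝 (f x)) := by
  have : Countable A := hA.to_subtype
  let restrict : WeakDual ℝ E → A → ℝ := fun f a => f a
  have hcont : Continuous restrict := continuous_pi fun a => WeakDual.eval_continuous a.1
  have hball := (WeakDual.isCompact_closedBall (0 : StrongDual ℝ E) R).image hcont
  obtain ⟨_, ⟨f, -, rfl⟩, κ, hκ, hlim⟩ := hball.tendsto_subseq
    fun n => Set.mem_image_of_mem restrict (x := StrongDual.toWeakDual (u n))
      (mem_closedBall_zero_iff.2 (hu n))
  have hbdd : ∃ C, ∀ n, ‖u (κ n)‖ ≤ C := ⟨R, fun n => hu (κ n)⟩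
  have hequi := ((NormedSpace.equicontinuous_TFAE fun n => u (κ n)).out 1 5).2 hbdd
  refine ⟨WeakDual.toStrongDual f, κ, hκ, fun x hx => ?_⟩
  exact closure_minimal (fun a ha => tendsto_pi_nhds.1 hlim ⟨a, ha⟩)
    (hequi.isClosed_setOfPred_tendsto (WeakDual.toStrongDual f).continuous) hx

theorem norm_le_norm_add_of_mem_closure {A : Set E} {b : E}
    (hA : ∀ a ∈ A, ∃ f : StrongDual ℝ E, ‖f‖ ≤ 1 ∧ f a = ‖a‖ ∧ f b = 0) {a : E}
    (ha : a ∈ closure A) : ‖a‖ ≤ ‖a + b‖ := by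
  refine closure_minimal ?_ (isClosed_le (f := fun a : E => ‖a‖) (g := fun a => ‖a + b‖)
    (by fun_prop) (by fun_prop)) ha
  intro a ha
  obtain ⟨f, hf, hfa, hfb⟩ := hA a ha
  calc ‖a‖ = f (a + b) := by rw [map_add, hfa, hfb, add_zero]
    _ ≤ ‖f (a + b)‖ := le_abs_self _
    _ ≤ ‖a + b‖ := f.le_of_opNorm_le_of_le hf le_rfl |>.trans_eq (one_mul _)

theorem isClosed_sup_of_norm_le_norm_add [CompleteSpace E] {A B : Submodule ℝ E}
    (hA : IsClosed (A : Set E)) (hB : IsClosed (B : Set E))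
    (h : ∀ a ∈ A, ∀ b ∈ B, ‖a‖ ≤ ‖a + b‖) : IsClosed ((A ⊔ B : Submodule ℝ E) : Set E) := by
  have : CompleteSpace A := hA.completeSpace_coe
  have : CompleteSpace B := hB.completeSpace_coe
  let add : A × B →L[ℝ] E := A.subtypeL.coprod B.subtypeL
  have hadd : AntilipschitzWith 2 add := add.antilipschitz_of_bound fun ⟨a, b⟩ => by
    have ha := h a a.2 b b.2
    have hb : ‖(b : E)‖ ≤ ‖(a + b : E)‖ + ‖(a : E)‖ := by simpa using norm_sub_le (a + b : E) a
    exact max_le (show ‖(a : E)‖ ≤ 2 * ‖(a + b : E)‖ by linarith [norm_nonneg (a + b : E)])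
      (show ‖(b : E)‖ ≤ 2 * ‖(a + b : E)‖ by linarith)
  convert hadd.isClosed_range add.uniformContinuous
  ext x
  simp [add, Submodule.mem_sup]

end Separation

/-! ### Norm-one projections onto norming hulls -/

section Hull

variable {E : Type*} [NormedAddCommGroup E] [NormedSpace ℝ E]

/-- A functional of norm at most one that attains the norm of `x`; the value `0` at `x = 0` keeps
the norming hull of the empty set trivial. -/
noncomputable def normingFunctional (x : E) : StrongDual ℝ E :=
  open Classical in if x = 0 then 0 else (exists_dual_vector'' ℝ x).choose

/-- A vector of norm at most one at which `f` attains its norm; the value is `0` if `f = 0` or if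
there is no such vector. -/
noncomputable def attainingVector (f : StrongDual ℝ E) : E :=
  open Classical in
  if h : f ≠ 0 ∧ ∃ x, ‖x‖ ≤ 1 ∧ f x = ‖f‖ then h.2.choose else 0

theorem normingFunctional_zero : normingFunctional (0 : E) = 0 := by
  simp [normingFunctional]

theorem norm_normingFunctional_le (x : E) : ‖normingFunctional x‖ ≤ 1 := by
  unfold normingFunctional
  split_ifs
  · simp
  · exact (exists_dual_vector'' ℝ x).choose_spec.1

theorem normingFunctional_apply_self (x : E) : normingFunctional x x = ‖x‖ := by
  unfold normingFunctional
  split_ifs with h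
  · simp [h]
  · exact (exists_dual_vector'' ℝ x).choose_spec.2

theorem attainingVector_zero : attainingVector (0 : StrongDual ℝ E) = 0 := by
  simp [attainingVector]

theorem norm_attainingVector_le (f : StrongDual ℝ E) : ‖attainingVector f‖ ≤ 1 := by
  unfold attainingVector
  split_ifs with h
  · exact h.2.choose_spec.1
  · simp

theorem IsReflexiveSpace.exists_apply_eq_norm (hE : IsReflexiveSpace E) (f : StrongDual ℝ E) :
    ∃ x, ‖x‖ ≤ 1 ∧ f x = ‖f‖ := by
  obtain ⟨g, hg, hgf⟩ := exists_dual_vector'' ℝ f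
  obtain ⟨x, rfl⟩ := hE g
  exact ⟨x, (NormedSpace.inclusionInDoubleDualLi ℝ).norm_map x ▸ hg, by simpa using hgf⟩

theorem IsReflexiveSpace.apply_attainingVector (hE : IsReflexiveSpace E) (f : StrongDual ℝ E) :
    f (attainingVector f) = ‖f‖ := by
  by_cases hf : f = 0
  · simp [hf]
  · have h : f ≠ 0 ∧ ∃ x, ‖x‖ ≤ 1 ∧ f x = ‖f‖ := ⟨hf, hE.exists_apply_eq_norm f⟩
    unfold attainingVector
    rw [dif_pos h]
    exact h.2.choose_spec.2

/-- The smallest subset of `E × E*` that contains `S × {0}` and `0`, is closed under rational linear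
combinations, and contains the pair of an attaining vector and a norming functional for each of
its elements. A rational vector space, unlike a real one, stays countable when `S` is. -/
inductive NormingHull (S : Set E) : Set (E × StrongDual ℝ E)
  | base {x} (hx : x ∈ S) : NormingHull S (x, 0)
  | zero : NormingHull S 0
  | rat_smul_add (c : ℚ) {z w} (hz : NormingHull S z) (hw : NormingHull S w) :
      NormingHull S ((c : ℝ) • z + w)
  | norming {z} (hz : NormingHull S z) :
      NormingHull S (attainingVector z.2, normingFunctional z.1)

theorem normingHull_mono {S T : Set E} (h : S ⊆ T) : NormingHull S ⊆ NormingHull T := by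
  intro z (hz : NormingHull S z)
  induction hz with
  | base hx => exact .base (h hx)
  | zero => exact .zero
  | rat_smul_add c _ _ hz hw => exact .rat_smul_add c hz hw
  | norming _ hz => exact .norming hz

theorem normingHull_empty : NormingHull (∅ : Set E) = {0} := by
  ext z
  refine ⟨fun (hz : NormingHull ∅ z) => ?_, fun hz => hz ▸ .zero⟩
  induction hz with
  | base hx => exact absurd hx (Set.notMem_empty _)
  | zero => rfl
  | rat_smul_add c _ _ hz hw => simp_all
  | norming _ hz => simp_all [normingFunctional_zero, attainingVector_zero]

theorem normingHull_iUnion_subset {ι : Type*} [Nonempty ι] {S : ι → Set E}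
    (hS : Directed (· ⊆ ·) S) : NormingHull (⋃ i, S i) ⊆ ⋃ i, NormingHull (S i) := by
  intro z (hz : NormingHull _ z)
  induction hz with
  | base hx =>
    obtain ⟨i, hi⟩ := Set.mem_iUnion.1 hx
    exact Set.mem_iUnion.2 ⟨i, .base hi⟩
  | zero => exact Set.mem_iUnion.2 ⟨Classical.arbitrary ι, .zero⟩
  | rat_smul_add c _ _ hz hw =>
    obtain ⟨i, hi⟩ := Set.mem_iUnion.1 hz
    obtain ⟨j, hj⟩ := Set.mem_iUnion.1 hw
    obtain ⟨k, hik, hjk⟩ := hS i j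
    exact Set.mem_iUnion.2
      ⟨k, .rat_smul_add c (normingHull_mono hik hi) (normingHull_mono hjk hj)⟩
  | norming _ hz =>
    obtain ⟨i, hi⟩ := Set.mem_iUnion.1 hz
    exact Set.mem_iUnion.2 ⟨i, .norming hi⟩

theorem normingHull_countable {S : Set E} (hS : S.Countable) : (NormingHull S).Countable := by
  let step : Set (E × StrongDual ℝ E) → Set (E × StrongDual ℝ E) := fun A =>
    A ∪ ((⋃ c : ℚ, Set.image2 (fun z w => (c : ℝ) • z + w) A A) ∪
      (fun z => (attainingVector z.2, normingFunctional z.1)) '' A)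
  let stage : ℕ → Set (E × StrongDual ℝ E) := fun k => step^[k] (insert 0 ((·, 0) '' S))
  have hsucc (k : ℕ) : stage (k + 1) = step (stage k) := Function.iterate_succ_apply' _ _ _
  have hcount (k : ℕ) : (stage k).Countable := by
    induction k with
    | zero => exact (hS.image _).insert 0
    | succ k ih =>
      rw [hsucc]
      exact ih.union ((Set.countable_iUnion fun c => ih.image2 ih _).union (ih.image _))
  have hmono : Monotone stage := monotone_nat_of_le_succ fun k => by
    rw [hsucc]
    exact Set.subset_union_left
  refine (Set.countable_iUnion hcount).mono fun z (hz : NormingHull S z) => ?_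
  induction hz with
  | base hx => exact Set.mem_iUnion.2 ⟨0, Or.inr ⟨_, hx, rfl⟩⟩
  | zero => exact Set.mem_iUnion.2 ⟨0, Or.inl rfl⟩
  | rat_smul_add c _ _ hz hw =>
    obtain ⟨i, hi⟩ := Set.mem_iUnion.1 hz
    obtain ⟨j, hj⟩ := Set.mem_iUnion.1 hw
    refine Set.mem_iUnion.2 ⟨max i j + 1, ?_⟩
    rw [hsucc]
    exact Or.inr (Or.inl (Set.mem_iUnion.2 ⟨c, Set.mem_image2_of_mem
      (hmono (le_max_left i j) hi) (hmono (le_max_right i j) hj)⟩))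
  | norming _ hz =>
    obtain ⟨i, hi⟩ := Set.mem_iUnion.1 hz
    refine Set.mem_iUnion.2 ⟨i + 1, ?_⟩
    rw [hsucc]
    exact Or.inr (Or.inr (Set.mem_image_of_mem _ hi))

theorem smul_add_mem_closure {A : Set E}
    (hA : ∀ c : ℚ, ∀ x ∈ A, ∀ y ∈ A, (c : ℝ) • x + y ∈ A) (c : ℝ) {x y : E}
    (hx : x ∈ closure A) (hy : y ∈ closure A) : c • x + y ∈ closure A := by
  have hc : c ∈ closure (Set.range ((↑) : ℚ → ℝ)) := Rat.denseRange_cast c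
  have hxy : (x, y) ∈ closure (A ×ˢ A) := by
    rw [closure_prod_eq]
    exact ⟨hx, hy⟩
  refine map_mem_closure₂ (f := fun (c : ℝ) (p : E × E) => c • p.1 + p.2) (by fun_prop) hc hxy ?_
  rintro _ ⟨c, rfl⟩ ⟨a, b⟩ ⟨ha, hb⟩
  exact hA c a ha b hb

/-- The closure of a set that is stable under rational linear combinations, as a real subspace. -/
def closureSubmodule (A : Set E) (h0 : (0 : E) ∈ A)
    (hA : ∀ c : ℚ, ∀ x ∈ A, ∀ y ∈ A, (c : ℝ) • x + y ∈ A) : Submodule ℝ E where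
  carrier := closure A
  zero_mem' := subset_closure h0
  add_mem' {x y} hx hy := by simpa only [one_smul] using smul_add_mem_closure hA 1 hx hy
  smul_mem' c x hx := by
    simpa only [add_zero] using smul_add_mem_closure hA c hx (subset_closure h0)

/-- The closed subspace of `E` generated by the vectors of the norming hull. -/
def hullSpace (S : Set E) : Submodule ℝ E :=
  closureSubmodule (Prod.fst '' NormingHull S) ⟨0, .zero, rfl⟩ (by
    rintro c _ ⟨z, hz, rfl⟩ _ ⟨w, hw, rfl⟩
    exact ⟨_, .rat_smul_add c hz hw, rfl⟩)

/-- The closed subspace of `E*` generated by the functionals of the norming hull. -/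
noncomputable def hullDual (S : Set E) : Submodule ℝ (StrongDual ℝ E) :=
  closureSubmodule (Prod.snd '' NormingHull S) ⟨0, .zero, rfl⟩ (by
    rintro c _ ⟨z, hz, rfl⟩ _ ⟨w, hw, rfl⟩
    exact ⟨_, .rat_smul_add c hz hw, rfl⟩)

/-- The common kernel of the functionals in `hullDual S`, which turns out to be a complement of
`hullSpace S`. -/
noncomputable def hullKer (S : Set E) : Submodule ℝ E :=
  ⨅ f ∈ hullDual S, LinearMap.ker (f : E →ₗ[ℝ] ℝ)

theorem mem_hullKer_iff {S : Set E} {x : E} : x ∈ hullKer S ↔ ∀ f ∈ hullDual S, f x = 0 := by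
  simp [hullKer, Submodule.mem_iInf]

theorem isClosed_hullSpace (S : Set E) : IsClosed (hullSpace S : Set E) := isClosed_closure

theorem isClosed_hullDual (S : Set E) : IsClosed (hullDual S : Set (StrongDual ℝ E)) :=
  isClosed_closure

theorem isClosed_hullKer (S : Set E) : IsClosed (hullKer S : Set E) := by
  simp only [hullKer, Submodule.coe_iInf]
  exact isClosed_biInter fun f _ => f.isClosed_ker

theorem subset_hullSpace (S : Set E) : S ⊆ hullSpace S :=
  fun x hx => subset_closure ⟨(x, 0), .base hx, rfl⟩

theorem hullSpace_mono {S T : Set E} (h : S ⊆ T) : hullSpace S ≤ hullSpace T :=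
  closure_mono (Set.image_mono (normingHull_mono h))

theorem hullKer_anti {S T : Set E} (h : S ⊆ T) : hullKer T ≤ hullKer S :=
  biInf_mono fun _ hf => closure_mono (Set.image_mono (normingHull_mono h)) hf

theorem norm_le_norm_add_of_mem_hullSpace {S : Set E} {a b : E} (ha : a ∈ hullSpace S)
    (hb : ∀ z ∈ NormingHull S, normingFunctional z.1 b = 0) : ‖a‖ ≤ ‖a + b‖ := by
  refine norm_le_norm_add_of_mem_closure ?_ ha
  rintro _ ⟨z, hz, rfl⟩
  exact ⟨_, norm_normingFunctional_le _, normingFunctional_apply_self _, hb z hz⟩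

theorem norm_le_norm_add_of_mem_hullKer {S : Set E} {a b : E} (ha : a ∈ hullSpace S)
    (hb : b ∈ hullKer S) : ‖a‖ ≤ ‖a + b‖ :=
  norm_le_norm_add_of_mem_hullSpace ha fun _ hz =>
    mem_hullKer_iff.1 hb _ (subset_closure ⟨_, .norming hz, rfl⟩)

theorem IsReflexiveSpace.mem_hullDual (hE : IsReflexiveSpace E) {S : Set E} {f : StrongDual ℝ E}
    (hf : ∀ x ∈ hullKer S, f x = 0) : f ∈ hullDual S := by
  by_contra h
  obtain ⟨Ξ, hΞ, hΞf⟩ := exists_dual_eq_zero_of_notMem (isClosed_hullDual S) h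
  obtain ⟨x, rfl⟩ := hE Ξ
  exact hΞf (hf x (mem_hullKer_iff.2 hΞ))

theorem IsReflexiveSpace.eq_zero_of_mem_hullDual (hE : IsReflexiveSpace E) {S : Set E}
    {f : StrongDual ℝ E} (hf : f ∈ hullDual S) (h0 : ∀ x ∈ hullSpace S, f x = 0) : f = 0 := by
  suffices ‖f‖ ≤ ‖f + -f‖ by simpa using this
  refine norm_le_norm_add_of_mem_closure ?_ hf
  rintro _ ⟨z, hz, rfl⟩
  refine ⟨NormedSpace.inclusionInDoubleDual ℝ E (attainingVector z.2),
    (NormedSpace.double_dual_bound ℝ E _).trans (norm_attainingVector_le _), ?_, ?_⟩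
  · exact hE.apply_attainingVector z.2
  · rw [map_neg, NormedSpace.dual_def, h0 _ (subset_closure ⟨_, .norming hz, rfl⟩), neg_zero]

variable [CompleteSpace E] (hE : IsReflexiveSpace E) {S T : Set E}

include hE in
theorem IsReflexiveSpace.isCompl_hull (S : Set E) : IsCompl (hullSpace S) (hullKer S) := by
  refine ⟨Submodule.disjoint_def.2 fun x hx hx' => ?_, codisjoint_iff.2 ?_⟩
  · simpa using norm_le_norm_add_of_mem_hullKer hx ((hullKer S).neg_mem hx')
  · refine eq_top_of_dual_eq_zero (isClosed_sup_of_norm_le_norm_add (isClosed_hullSpace S)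
      (isClosed_hullKer S) fun a ha b hb => norm_le_norm_add_of_mem_hullKer ha hb) fun f hf => ?_
    exact hE.eq_zero_of_mem_hullDual (hE.mem_hullDual fun y hy => hf y (Submodule.mem_sup_right hy))
      fun y hy => hf y (Submodule.mem_sup_left hy)

/-- The norm-one projection of a reflexive space onto `hullSpace S` along `hullKer S`. -/
noncomputable def hullProj (S : Set E) : E →L[ℝ] E :=
  ((hullSpace S).projection (hullKer S) (hE.isCompl_hull S)).mkContinuous 1 fun x => by
    rw [one_mul]
    refine (norm_le_norm_add_of_mem_hullKer (Submodule.projection_apply_mem _ x)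
      (Submodule.sub_projection_mem (hE.isCompl_hull S) x)).trans_eq ?_
    rw [add_sub_cancel]

theorem norm_hullProj_le (x : E) : ‖hullProj hE S x‖ ≤ ‖x‖ := by
  simpa only [one_mul] using
    (hullProj hE S).le_of_opNorm_le (LinearMap.mkContinuous_norm_le _ zero_le_one _) x

theorem hullProj_mem (x : E) : hullProj hE S x ∈ hullSpace S :=
  Submodule.projection_apply_mem (hE.isCompl_hull S) x

theorem hullProj_eq_self {x : E} (hx : x ∈ hullSpace S) : hullProj hE S x = x :=
  Submodule.projection_apply_of_mem_left (hE.isCompl_hull S) hx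

theorem hullProj_eq_zero {x : E} (hx : x ∈ hullKer S) : hullProj hE S x = 0 :=
  (Submodule.projection_apply_eq_zero_iff (hE.isCompl_hull S)).2 hx

theorem hullProj_hullProj_of_subset (h : S ⊆ T) (x : E) :
    hullProj hE T (hullProj hE S x) = hullProj hE S x :=
  hullProj_eq_self hE (hullSpace_mono h (hullProj_mem hE x))

theorem hullProj_hullProj_of_superset (h : S ⊆ T) (x : E) :
    hullProj hE S (hullProj hE T x) = hullProj hE S x := by
  have hx := hullProj_eq_zero hE
    (hullKer_anti h (Submodule.sub_projection_mem (hE.isCompl_hull T) x))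
  rw [map_sub, sub_eq_zero] at hx
  exact hx.symm

theorem hullProj_empty (x : E) : hullProj hE ∅ x = 0 := by
  have hx : hullProj hE ∅ x ∈ closure (Prod.fst '' NormingHull (∅ : Set E)) := hullProj_mem hE x
  simpa [normingHull_empty] using hx

theorem comp_hullProj_mem_hullDual (f : StrongDual ℝ E) : f.comp (hullProj hE S) ∈ hullDual S :=
  hE.mem_hullDual fun x hx => by simp [hullProj_eq_zero hE hx]

theorem exists_norm_hullProj_iUnion_sub_le {ι : Type*} [Nonempty ι] {S : ι → Set E}
    (hS : Directed (· ⊆ ·) S) (x : E) {ε : ℝ} (hε : 0 < ε) :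
    ∃ i, ‖hullProj hE (⋃ j, S j) x - hullProj hE (S i) x‖ ≤ ε := by
  set y := hullProj hE (⋃ j, S j) x with hy
  obtain ⟨_, ⟨z, hz, rfl⟩, hzy⟩ :=
    Metric.mem_closure_iff.1 (hullProj_mem hE (S := ⋃ j, S j) x) (ε / 2) (half_pos hε)
  obtain ⟨i, hi⟩ := Set.mem_iUnion.1 (normingHull_iUnion_subset hS hz)
  have hzi : hullProj hE (S i) z.1 = z.1 := hullProj_eq_self hE (subset_closure ⟨z, hi, rfl⟩)
  have hsub : y - hullProj hE (S i) x = (y - z.1) - hullProj hE (S i) (y - z.1) := by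
    rw [map_sub, hzi, hy, hullProj_hullProj_of_superset hE (Set.subset_iUnion S i),
      sub_sub_sub_cancel_right]
  refine ⟨i, ?_⟩
  calc ‖y - hullProj hE (S i) x‖ ≤ ‖y - z.1‖ + ‖hullProj hE (S i) (y - z.1)‖ :=
        hsub ▸ norm_sub_le _ _
    _ ≤ ‖y - z.1‖ + ‖y - z.1‖ := by gcongr; exact norm_hullProj_le hE _
    _ ≤ ε := by linarith [(dist_eq_norm y z.1).symm.trans_lt hzy]

include hE in
theorem IsReflexiveSpace.exists_subseq_tendsto_weakly {v : ℕ → E} {R : ℝ}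
    (hv : ∀ n, ‖v n‖ ≤ R) : ∃ x : E, ∃ κ : ℕ → ℕ, StrictMono κ ∧
      ∀ f : StrongDual ℝ E, Tendsto (fun n => f (v (κ n))) atTop (𝓝 (f x)) := by
  have hcount := (normingHull_countable (Set.countable_range v)).image Prod.snd
  obtain ⟨Ξ, κ, hκ, hlim⟩ := exists_subseq_tendsto_on_closure hcount
    (u := fun n => NormedSpace.inclusionInDoubleDual ℝ E (v n))
    fun n => (NormedSpace.double_dual_bound ℝ E (v n)).trans (hv n)
  have hproj (f : StrongDual ℝ E) (n : ℕ) : f (hullProj hE (Set.range v) (v n)) = f (v n) := by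
    rw [hullProj_eq_self hE (subset_hullSpace _ (Set.mem_range_self n))]
  obtain ⟨x, hx⟩ :=
    hE (Ξ.comp ((ContinuousLinearMap.compL ℝ E E ℝ).flip (hullProj hE (Set.range v))))
  refine ⟨x, κ, hκ, fun f => ?_⟩
  rw [← NormedSpace.dual_def ℝ E x f, hx]
  exact (hlim _ (comp_hullProj_mem_hullDual hE f)).congr fun n => hproj f (κ n)

end Hull

section Dual

variable {E : Type*} [NormedAddCommGroup E] [NormedSpace ℝ E]

theorem IsReflexiveSpace.strongDual (hE : IsReflexiveSpace E) :
    IsReflexiveSpace (StrongDual ℝ E) := by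
  intro Θ
  refine ⟨Θ.comp (NormedSpace.inclusionInDoubleDual ℝ E), ContinuousLinearMap.ext fun Ξ => ?_⟩
  obtain ⟨x, rfl⟩ := hE Ξ
  rfl

theorem IsReflexiveSpace.exists_subseq_tendsto_dual (hE : IsReflexiveSpace E)
    {u : ℕ → StrongDual ℝ E} {R : ℝ}
    (hu : ∀ n, ‖u n‖ ≤ R) : ∃ f : StrongDual ℝ E, ∃ κ : ℕ → ℕ, StrictMono κ ∧
      ∀ x, Tendsto (fun n => u (κ n) x) atTop (𝓝 (f x)) := by
  obtain ⟨f, κ, hκ, hlim⟩ := hE.strongDual.exists_subseq_tendsto_weakly hu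
  exact ⟨f, κ, hκ, fun x => hlim (NormedSpace.inclusionInDoubleDual ℝ E x)⟩

end Dual

/-! ### Total null families -/

section NullFamily

universe u

/-- `F` is a family of functionals in the dual unit ball such that `(F γ x)_γ` belongs to `c₀` for
every `x`, and which separates the points of `L` from `0`. -/
structure IsTotalNullFamily {E : Type*} [NormedAddCommGroup E] [NormedSpace ℝ E] {Γ : Type*}
    (F : Γ → StrongDual ℝ E) (L : Submodule ℝ E) : Prop where
  norm_le_one : ∀ γ, ‖F γ‖ ≤ 1
  tendsto_zero : ∀ x, Tendsto (fun γ => F γ x) cofinite (𝓝 0)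
  eq_zero : ∀ x ∈ L, (∀ γ, F γ x = 0) → x = 0

theorem tendsto_cofinite_zero_iff {ι E : Type*} [NormedAddCommGroup E] {a : ι → E} :
    Tendsto a cofinite (𝓝 0) ↔ ∀ ε > 0, {i | ε ≤ ‖a i‖}.Finite := by
  simp [Metric.tendsto_nhds, eventually_cofinite]

theorem tendsto_cofinite_sigma_zero {I : Type*} {Γ : I → Type*} {a : (Σ i, Γ i) → ℝ} {b : I → ℝ}
    (hb : Tendsto b cofinite (𝓝 0)) (hab : ∀ i γ, |a ⟨i, γ⟩| ≤ b i)
    (ha : ∀ i, Tendsto (fun γ => a ⟨i, γ⟩) cofinite (𝓝 0)) : Tendsto a cofinite (𝓝 0) := by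
  simp only [tendsto_cofinite_zero_iff] at *
  intro ε hε
  refine ((hb ε hε).biUnion fun i _ => (ha i ε hε).image (Sigma.mk i)).subset ?_
  rintro ⟨i, γ⟩ hγ
  exact Set.mem_biUnion (hγ.trans ((hab i γ).trans (le_abs_self _))) ⟨γ, hγ, rfl⟩

theorem directed_restrict {I α : Type*} [LinearOrder I] {U : I → Set α} (hU : Monotone U)
    (D : Set I) : Directed (· ⊆ ·) fun i : D => U i :=
  fun i j => (le_total i.1 j.1).elim (fun h => ⟨j, hU h, subset_rfl⟩)
    fun h => ⟨i, subset_rfl, hU h⟩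

variable {E : Type u} [NormedAddCommGroup E] [NormedSpace ℝ E]

theorem exists_isTotalNullFamily_of_countable {S : Set E} (hS : S.Countable) :
    ∃ (Γ : Type u) (F : Γ → StrongDual ℝ E), IsTotalNullFamily F (hullSpace S) := by
  have := (normingHull_countable hS).to_subtype
  obtain ⟨_⟩ := nonempty_encodable (NormingHull S)
  let weight (z : NormingHull S) : ℝ := 1 / ((Encodable.encode z : ℝ) + 1)
  have hpos (z) : 0 < weight z := by positivity
  have hle (z) : weight z ≤ 1 := (div_le_one (by positivity)).2 (by simp)
  have hweight : Tendsto weight cofinite (𝓝 0) :=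
    tendsto_one_div_add_atTop_nhds_zero_nat.comp
      (Nat.cofinite_eq_atTop ▸ Encodable.encode_injective.tendsto_cofinite)
  have hnorm (z) : ‖weight z • normingFunctional z.1.1‖ ≤ weight z := by
    rw [norm_smul, Real.norm_of_nonneg (hpos z).le]
    exact mul_le_of_le_one_right (hpos z).le (norm_normingFunctional_le _)
  refine ⟨NormingHull S, fun z => weight z • normingFunctional z.1.1,
    fun z => (hnorm z).trans (hle z), fun x => ?_, fun x hx h0 => ?_⟩
  · exact squeeze_zero_norm (fun z => ContinuousLinearMap.le_of_opNorm_le _ (hnorm z) x)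
      (by simpa using hweight.mul_const ‖x‖)
  · suffices ‖x‖ ≤ ‖x + -x‖ by simpa using this
    refine norm_le_norm_add_of_mem_hullSpace hx fun z hz => ?_
    have : normingFunctional z.1 x = 0 :=
      (mul_eq_zero.1 (h0 ⟨z, hz⟩)).resolve_left (hpos _).ne'
    rw [map_neg, this, neg_zero]

variable [CompleteSpace E] (hE : IsReflexiveSpace E)
  {I : Type*} [LinearOrder I] {U : I → Set E}

/-- The increment at the index `i` of the chain of projections attached to a chain of sets. -/
noncomputable def hullIncr (U : I → Set E) (i : I) : E →L[ℝ] E :=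
  hullProj hE (U i) - hullProj hE (⋃ j : Set.Iio i, U j)

theorem hullIncr_apply (i : I) (x : E) : hullIncr hE U i x =
    hullProj hE (U i) x - hullProj hE (⋃ j : Set.Iio i, U j) x := rfl

theorem norm_hullIncr_le (i : I) (x : E) : ‖hullIncr hE U i x‖ ≤ 2 * ‖x‖ := by
  rw [two_mul]
  exact (norm_sub_le _ _).trans (add_le_add (norm_hullProj_le hE x) (norm_hullProj_le hE x))

theorem hullIncr_mem (hU : Monotone U) (i : I) (x : E) : hullIncr hE U i x ∈ hullSpace (U i) :=
  (hullSpace (U i)).sub_mem (hullProj_mem hE x)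
    (hullSpace_mono (Set.iUnion_subset fun j => hU j.2.le) (hullProj_mem hE x))

theorem hullIncr_hullProj_sub (hU : Monotone U) {D : Set I} {i j : I} (hij : i < j) (hj : j ∈ D)
    (x : E) : hullIncr hE U j (hullProj hE (⋃ k : D, U k) x - hullProj hE (U i) x) =
      hullIncr hE U j x := by
  have hiL : U i ⊆ ⋃ k : Set.Iio j, U k :=
    Set.subset_iUnion (fun k : Set.Iio j => U k) ⟨i, hij⟩
  have hjD : U j ⊆ ⋃ k : D, U k := Set.subset_iUnion (fun k : D => U k) ⟨j, hj⟩
  have hLD : (⋃ k : Set.Iio j, U k) ⊆ ⋃ k : D, U k :=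
    Set.iUnion_subset fun k => (hU k.2.le).trans hjD
  simp only [hullIncr_apply, map_sub,
    hullProj_hullProj_of_superset hE hjD, hullProj_hullProj_of_superset hE hLD,
    hullProj_hullProj_of_subset hE (hU hij.le), hullProj_hullProj_of_subset hE hiL]
  abel

theorem finite_hullIncr_of_isLowerSet (hU : Monotone U) {D : Set I} (x : E) {ε : ℝ} (hε : 0 < ε)
    (hfin : ∀ i ∈ D, {j | j < i ∧ ε ≤ ‖hullIncr hE U j x‖}.Finite) :
    {j | j ∈ D ∧ ε ≤ ‖hullIncr hE U j x‖}.Finite := by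
  rcases D.eq_empty_or_nonempty with rfl | hne
  · simp
  have : Nonempty D := hne.to_subtype
  obtain ⟨⟨i, hi⟩, hix⟩ := exists_norm_hullProj_iUnion_sub_le hE (directed_restrict hU D) x
    (show 0 < ε / 4 by positivity)
  refine ((hfin i hi).insert i).subset ?_
  rintro j ⟨hj, hjx⟩
  rcases lt_trichotomy j i with h | rfl | h
  · exact Or.inr ⟨h, hjx⟩
  · exact Or.inl rfl
  · rw [← hullIncr_hullProj_sub hE hU h hj x] at hjx
    have := norm_hullIncr_le hE (U := U) j (hullProj hE (⋃ k : D, U k) x - hullProj hE (U i) x)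
    linarith

theorem tendsto_hullIncr_cofinite_zero [WellFoundedLT I] (hU : Monotone U) (x : E) :
    Tendsto (fun i => hullIncr hE U i x) cofinite (𝓝 0) := by
  refine tendsto_cofinite_zero_iff.2 fun ε hε => ?_
  have hfin : ∀ i : I, {j | j < i ∧ ε ≤ ‖hullIncr hE U j x‖}.Finite := by
    intro i
    induction i using WellFoundedLT.induction with
    | ind i ih => exact finite_hullIncr_of_isLowerSet hE hU (D := Set.Iio i) x hε ih
  simpa using finite_hullIncr_of_isLowerSet hE hU (D := Set.univ) x hε fun i _ => hfin i

theorem hullProj_iUnion_eq_zero (hU : Monotone U) {D : Set I} {x : E}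
    (h : ∀ i ∈ D, hullProj hE (U i) x = 0) : hullProj hE (⋃ j : D, U j) x = 0 := by
  rcases D.eq_empty_or_nonempty with rfl | hne
  · simpa using hullProj_empty hE x
  have : Nonempty D := hne.to_subtype
  refine norm_le_zero_iff.1 (le_of_forall_pos_le_add fun ε hε => ?_)
  obtain ⟨⟨i, hi⟩, hix⟩ := exists_norm_hullProj_iUnion_sub_le hE (directed_restrict hU D) x hε
  simpa [h i hi] using hix

theorem eq_zero_of_hullIncr_eq_zero [WellFoundedLT I] (hU : Monotone U) {x : E}
    (hx : x ∈ hullSpace (⋃ i, U i)) (h : ∀ i, hullIncr hE U i x = 0) : x = 0 := by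
  have hproj : ∀ i, hullProj hE (U i) x = 0 := by
    intro i
    induction i using WellFoundedLT.induction with
    | ind i ih => exact (sub_eq_zero.1 (h i)).trans (hullProj_iUnion_eq_zero hE hU ih)
  rw [← hullProj_eq_self hE hx]
  simpa [Set.iUnion_coe_set] using
    hullProj_iUnion_eq_zero hE hU (D := Set.univ) fun i _ => hproj i

end NullFamily

section AmirLindenstrauss

universe u

variable {E : Type u} [NormedAddCommGroup E] [NormedSpace ℝ E] [CompleteSpace E]

theorem IsReflexiveSpace.exists_isTotalNullFamily_iUnion (hE : IsReflexiveSpace E) {I : Type u}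
    [LinearOrder I] [WellFoundedLT I] {U : I → Set E} (hU : Monotone U)
    (h : ∀ i, ∃ (Γ : Type u) (F : Γ → StrongDual ℝ E), IsTotalNullFamily F (hullSpace (U i))) :
    ∃ (Γ : Type u) (F : Γ → StrongDual ℝ E), IsTotalNullFamily F (hullSpace (⋃ i, U i)) := by
  choose Γ F hF using h
  refine ⟨Σ i, Γ i, fun γ => (2⁻¹ : ℝ) • (F γ.1 γ.2).comp (hullIncr hE U γ.1), ?_, ?_, ?_⟩
  · rintro ⟨i, γ⟩
    refine ContinuousLinearMap.opNorm_le_bound _ zero_le_one fun x => ?_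
    have hcoord := (F i γ).le_of_opNorm_le ((hF i).norm_le_one γ) (hullIncr hE U i x)
    have hincr := norm_hullIncr_le hE (U := U) i x
    simp only [smul_apply, ContinuousLinearMap.comp_apply, norm_smul, norm_inv,
      Real.norm_ofNat]
    linarith
  · intro x
    refine tendsto_cofinite_sigma_zero (b := fun i => ‖hullIncr hE U i x‖)
      (by simpa using (tendsto_hullIncr_cofinite_zero hE hU x).norm) (fun i γ => ?_) fun i => ?_
    · have hcoord := (F i γ).le_of_opNorm_le ((hF i).norm_le_one γ) (hullIncr hE U i x)
      rw [Real.norm_eq_abs] at hcoord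
      simp only [smul_apply, ContinuousLinearMap.comp_apply, smul_eq_mul,
        abs_mul, abs_inv, Nat.abs_ofNat]
      linarith [norm_nonneg (hullIncr hE U i x)]
    · simpa using ((hF i).tendsto_zero (hullIncr hE U i x)).const_mul 2⁻¹
  · intro x hx h0
    refine eq_zero_of_hullIncr_eq_zero hE hU hx fun i => ?_
    refine (hF i).eq_zero _ (hullIncr_mem hE hU i x) fun γ => ?_
    simpa using h0 ⟨i, γ⟩

theorem exists_chain_of_aleph0_lt {α : Type u} {S : Set α} (hS : Cardinal.aleph0 < Cardinal.mk S) :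
    ∃ (I : Type u) (_ : LinearOrder I) (_ : WellFoundedLT I) (U : I → Set α), Monotone U ∧
      ⋃ i, U i = S ∧ ∀ i, Cardinal.mk (U i) < Cardinal.mk S := by
  obtain ⟨e⟩ : Nonempty ((Cardinal.mk S).ord.ToType ≃ S) := by
    rw [← Cardinal.eq, Cardinal.mk_ord_toType]
  refine ⟨(Cardinal.mk S).ord.ToType, inferInstance, inferInstance,
    fun i => (fun j => (e j).1) '' Set.Iic i,
    fun i j hij => Set.image_mono (Set.Iic_subset_Iic.2 hij), ?_, fun i => ?_⟩
  · rw [← Set.image_iUnion, Set.iUnion_Iic, Set.image_univ]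
    exact (e.surjective.range_comp _).trans Subtype.range_coe
  · have hIio : Cardinal.mk (Set.Iio i) < Cardinal.mk S := by simpa using Cardinal.mk_Iio_lt i
    calc Cardinal.mk ((fun j => (e j).1) '' Set.Iic i) ≤ Cardinal.mk (Set.Iic i) :=
          Cardinal.mk_image_le
      _ = Cardinal.mk (insert i (Set.Iio i) : Set _) := by rw [Set.Iio_insert]
      _ ≤ Cardinal.mk (Set.Iio i) + 1 := Cardinal.mk_insert_le
      _ < Cardinal.mk S := Cardinal.add_lt_of_lt hS.le hIio (Cardinal.one_lt_aleph0.trans hS)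

theorem IsReflexiveSpace.exists_isTotalNullFamily_hullSpace (hE : IsReflexiveSpace E) (S : Set E) :
    ∃ (Γ : Type u) (F : Γ → StrongDual ℝ E), IsTotalNullFamily F (hullSpace S) := by
  induction hκ : Cardinal.mk S using WellFoundedLT.induction generalizing S with
  | ind κ ih =>
    subst hκ
    rcases le_or_gt (Cardinal.mk S) Cardinal.aleph0 with hS | hS
    · exact exists_isTotalNullFamily_of_countable (Cardinal.le_aleph0_iff_set_countable.1 hS)
    · obtain ⟨I, _, _, U, hU, hUS, hcard⟩ := exists_chain_of_aleph0_lt hS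
      rw [← hUS]
      exact hE.exists_isTotalNullFamily_iUnion hU fun i => ih _ (hcard i) (U i) rfl

theorem IsReflexiveSpace.exists_isTotalNullFamily (hE : IsReflexiveSpace E) :
    ∃ (Γ : Type u) (F : Γ → StrongDual ℝ E), IsTotalNullFamily F ⊤ := by
  obtain ⟨Γ, F, hF⟩ := hE.exists_isTotalNullFamily_hullSpace Set.univ
  exact ⟨Γ, F, hF.norm_le_one, hF.tendsto_zero,
    fun x _ => hF.eq_zero x (subset_hullSpace _ (Set.mem_univ x))⟩

end AmirLindenstrauss

/-! ### A smooth gauge on a reflexive space -/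

section Semicontinuity

variable {X : Type*} [TopologicalSpace X] {K : Set X}

theorem lowerSemicontinuousOn_tsum_of_nonneg {ι : Type*} {g : ι → X → ℝ}
    (h0 : ∀ i, ∀ p ∈ K, 0 ≤ g i p) (hs : ∀ p ∈ K, Summable fun i => g i p)
    (hg : ∀ i, LowerSemicontinuousOn (g i) K) :
    LowerSemicontinuousOn (fun p => ∑' i, g i p) K := by
  intro p hp y hy
  obtain ⟨s, hsy⟩ := ((hs p hp).hasSum.eventually (lt_mem_nhds hy)).exists
  have hfin : LowerSemicontinuousOn (fun p => ∑ i ∈ s, g i p) K :=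
    lowerSemicontinuousOn_sum fun i _ => hg i
  filter_upwards [hfin p hp y hsy, self_mem_nhdsWithin] with p' hp' hK
  exact hp'.trans_le ((hs p' hK).sum_le_tsum s fun i _ => h0 i p' hK)

theorem lowerSemicontinuousOn_sq_of_nonneg {g : X → ℝ} (hg : LowerSemicontinuousOn g K)
    (h0 : ∀ p ∈ K, 0 ≤ g p) : LowerSemicontinuousOn (fun p => g p ^ 2) K := by
  intro p hp y hy
  rcases lt_or_ge y 0 with hy0 | hy0
  · exact Eventually.of_forall fun p' => hy0.trans_le (sq_nonneg _)
  · have hsqrt : √y < g p := (Real.sqrt_lt_sqrt hy0 hy).trans_eq (Real.sqrt_sq (h0 p hp))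
    filter_upwards [hg p hp _ hsqrt] with p' hp'
    calc y = √y ^ 2 := (Real.sq_sqrt hy0).symm
      _ < g p' ^ 2 := by gcongr

theorem lowerSemicontinuousOn_norm_of_continuousOn_apply {E : Type*} [NormedAddCommGroup E]
    [NormedSpace ℝ E] {g : X → StrongDual ℝ E} (hg : ∀ x, ContinuousOn (fun p => g p x) K) :
    LowerSemicontinuousOn (fun p => ‖g p‖) K := by
  intro p hp y hy
  rcases lt_or_ge y 0 with hy0 | -
  · exact Eventually.of_forall fun p' => hy0.trans_le (norm_nonneg _)
  obtain ⟨x, hx, hyx⟩ := ContinuousLinearMap.exists_lt_apply_of_lt_opNorm _ hy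
  filter_upwards [((hg x).norm p hp).eventually (lt_mem_nhds hyx)] with p' hp'
  exact hp'.trans_le (((g p').le_opNorm x).trans (mul_le_of_le_one_right (norm_nonneg _) hx.le))

end Semicontinuity

section SummableFamilies

/-- The closed unit ball of `ℓ¹(Γ)`, as a subset of the product `Γ → ℝ`, in which it is compact. -/
def l1Ball (Γ : Type*) : Set (Γ → ℝ) := {a | ∀ s : Finset Γ, ∑ γ ∈ s, |a γ| ≤ 1}

variable {Γ : Type*} {a b : Γ → ℝ}

theorem isCompact_l1Ball : IsCompact (l1Ball Γ) := by
  have h : IsCompact (Set.pi Set.univ fun _ : Γ => Set.Icc (-1 : ℝ) 1) :=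
    isCompact_univ_pi fun _ => isCompact_Icc
  refine h.of_isClosed_subset ?_ fun a ha γ _ => abs_le.1 (by simpa using ha {γ})
  rw [l1Ball, Set.ofPred_forall]
  exact isClosed_iInter fun s => isClosed_le (by fun_prop) continuous_const

theorem zero_mem_l1Ball : (0 : Γ → ℝ) ∈ l1Ball Γ := fun s => by simp

theorem mem_l1Ball_of_tsum_abs_le (ha : Summable fun γ => |a γ|) (h1 : ∑' γ, |a γ| ≤ 1) :
    a ∈ l1Ball Γ := fun s => (ha.sum_le_tsum s fun _ _ => abs_nonneg _).trans h1

theorem summable_abs_of_mem_l1Ball (ha : a ∈ l1Ball Γ) : Summable fun γ => |a γ| :=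
  summable_of_sum_le (fun _ => abs_nonneg _) ha

theorem tsum_abs_le_of_mem_l1Ball (ha : a ∈ l1Ball Γ) : ∑' γ, |a γ| ≤ 1 :=
  (summable_abs_of_mem_l1Ball ha).tsum_le_of_sum_le ha

theorem midpoint_mem_l1Ball (ha : a ∈ l1Ball Γ) (hb : b ∈ l1Ball Γ) :
    (2⁻¹ : ℝ) • (a + b) ∈ l1Ball Γ := by
  intro s
  calc ∑ γ ∈ s, |((2⁻¹ : ℝ) • (a + b)) γ| ≤ ∑ γ ∈ s, 2⁻¹ * (|a γ| + |b γ|) := by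
        refine Finset.sum_le_sum fun γ _ => ?_
        simp only [Pi.smul_apply, Pi.add_apply, smul_eq_mul, abs_mul, abs_inv, Nat.abs_ofNat]
        gcongr
        exact abs_add_le _ _
    _ = 2⁻¹ * (∑ γ ∈ s, |a γ| + ∑ γ ∈ s, |b γ|) := by
        rw [← Finset.mul_sum, Finset.sum_add_distrib]
    _ ≤ 1 := by linarith [ha s, hb s]

theorem summable_abs_sub (ha : Summable fun γ => |a γ|) (hb : Summable fun γ => |b γ|) :
    Summable fun γ => |a γ - b γ| :=
  (ha.add hb).of_nonneg_of_le (fun _ => abs_nonneg _) fun _ => abs_sub _ _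

theorem summable_sq_of_summable_abs (ha : Summable fun γ => |a γ|) :
    Summable fun γ => a γ ^ 2 := by
  refine (ha.mul_left (∑' γ, |a γ|)).of_nonneg_of_le (fun _ => sq_nonneg _) fun γ => ?_
  rw [← sq_abs, sq]
  gcongr
  exact ha.le_tsum γ fun _ _ => abs_nonneg _

theorem tsum_sq_le_sq_tsum_abs (ha : Summable fun γ => |a γ|) :
    ∑' γ, a γ ^ 2 ≤ (∑' γ, |a γ|) ^ 2 := by
  rw [sq (∑' γ, |a γ|), ← tsum_mul_left]
  refine (summable_sq_of_summable_abs ha).tsum_le_tsum (fun γ => ?_) (ha.mul_left _)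
  rw [← sq_abs, sq]
  gcongr
  exact ha.le_tsum γ fun _ _ => abs_nonneg _

theorem tsum_abs_midpoint_le (ha : Summable fun γ => |a γ|) (hb : Summable fun γ => |b γ|) :
    ∑' γ, |((2⁻¹ : ℝ) • (a + b)) γ| ≤ (∑' γ, |a γ| + ∑' γ, |b γ|) / 2 := by
  have hle (γ : Γ) : |((2⁻¹ : ℝ) • (a + b)) γ| ≤ (|a γ| + |b γ|) / 2 := by
    simp only [Pi.smul_apply, Pi.add_apply, smul_eq_mul, abs_mul, abs_inv, Nat.abs_ofNat]
    linarith [abs_add_le (a γ) (b γ)]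
  have hs := (ha.add hb).div_const 2
  rw [← ha.tsum_add hb, ← tsum_div_const]
  exact (hs.of_nonneg_of_le (fun _ => abs_nonneg _) hle).tsum_le_tsum hle hs

theorem tsum_sq_midpoint_add (ha : Summable fun γ => a γ ^ 2) (hb : Summable fun γ => b γ ^ 2)
    (hab : Summable fun γ => (a γ - b γ) ^ 2) :
    ∑' γ, ((2⁻¹ : ℝ) • (a + b)) γ ^ 2 + (∑' γ, (a γ - b γ) ^ 2) / 4 =
      (∑' γ, a γ ^ 2 + ∑' γ, b γ ^ 2) / 2 := by
  have hpt (γ : Γ) : ((2⁻¹ : ℝ) • (a + b)) γ ^ 2 =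
      (a γ ^ 2 + b γ ^ 2) / 2 - (a γ - b γ) ^ 2 / 4 := by
    simp only [Pi.smul_apply, Pi.add_apply, smul_eq_mul]
    ring
  simp only [hpt]
  rw [((ha.add hb).div_const 2).tsum_sub (hab.div_const 4), tsum_div_const, tsum_div_const,
    ha.tsum_add hb]
  ring

/- The dominated sums are those of `|a| + |b| - |b - a|`, which lies between `0` and `2 |a|`. -/
theorem tendsto_tsum_abs_sub {ι : Type*} {l : Filter ι} {b : ι → Γ → ℝ}
    (ha : Summable fun γ => |a γ|) (hb : ∀ k, Summable fun γ => |b k γ|)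
    (hab : ∀ γ, Tendsto (fun k => b k γ) l (𝓝 (a γ)))
    (hn : Tendsto (fun k => ∑' γ, |b k γ|) l (𝓝 (∑' γ, |a γ|))) :
    Tendsto (fun k => ∑' γ, |b k γ - a γ|) l (𝓝 0) := by
  have hdom : Tendsto (fun k => ∑' γ, (|a γ| + |b k γ| - |b k γ - a γ|)) l
      (𝓝 (∑' γ, (|a γ| + |a γ| - |a γ - a γ|))) := by
    refine tendsto_tsum_of_dominated_convergence (bound := fun γ => 2 * |a γ|) (ha.mul_left 2)
      (fun γ => ((tendsto_const_nhds.add (hab γ).abs).sub ((hab γ).sub_const _).abs))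
      (Eventually.of_forall fun k γ => ?_)
    rw [Real.norm_eq_abs, abs_le]
    have := abs_sub_abs_le_abs_sub (b k γ) (a γ)
    have := abs_sub (b k γ) (a γ)
    constructor <;> linarith [abs_nonneg (a γ)]
  have hsplit (k) : ∑' γ, (|a γ| + |b k γ| - |b k γ - a γ|) =
      ∑' γ, |a γ| + ∑' γ, |b k γ| - ∑' γ, |b k γ - a γ| := by
    rw [(ha.add (hb k)).tsum_sub (summable_abs_sub (hb k) ha), ha.tsum_add (hb k)]
  simp only [hsplit, sub_self, abs_zero, sub_zero, ha.tsum_add ha] at hdom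
  simpa using ((tendsto_const_nhds (x := ∑' γ, |a γ|)).add hn).sub hdom

variable {E : Type*} [NormedAddCommGroup E] [NormedSpace ℝ E] {F : Γ → StrongDual ℝ E}

/-- The functional `∑ γ, a γ • F γ` with coefficients `a`. -/
noncomputable def synth (F : Γ → StrongDual ℝ E) (a : Γ → ℝ) : StrongDual ℝ E := ∑' γ, a γ • F γ

theorem norm_smul_le_abs (hF : ∀ γ, ‖F γ‖ ≤ 1) (γ : Γ) : ‖a γ • F γ‖ ≤ |a γ| := by
  rw [norm_smul]
  exact mul_le_of_le_one_right (abs_nonneg _) (hF γ)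

theorem summable_norm_synth (hF : ∀ γ, ‖F γ‖ ≤ 1) (ha : Summable fun γ => |a γ|) :
    Summable fun γ => ‖a γ • F γ‖ :=
  ha.of_nonneg_of_le (fun _ => norm_nonneg _) (norm_smul_le_abs hF)

theorem hasSum_synth_apply (hF : ∀ γ, ‖F γ‖ ≤ 1) (ha : Summable fun γ => |a γ|) (x : E) :
    HasSum (fun γ => a γ * F γ x) (synth F a x) :=
  (summable_norm_synth hF ha).of_norm.hasSum.mapL (ContinuousLinearMap.apply ℝ ℝ x)

theorem norm_synth_le (hF : ∀ γ, ‖F γ‖ ≤ 1) (ha : Summable fun γ => |a γ|) :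
    ‖synth F a‖ ≤ ∑' γ, |a γ| :=
  (norm_tsum_le_tsum_norm (summable_norm_synth hF ha)).trans
    ((summable_norm_synth hF ha).tsum_le_tsum (norm_smul_le_abs hF) ha)

theorem synth_sub (hF : ∀ γ, ‖F γ‖ ≤ 1) (ha : Summable fun γ => |a γ|)
    (hb : Summable fun γ => |b γ|) : synth F (a - b) = synth F a - synth F b := by
  unfold synth
  rw [← (summable_norm_synth hF ha).of_norm.tsum_sub (summable_norm_synth hF hb).of_norm]
  exact tsum_congr fun γ => sub_smul (a γ) (b γ) (F γ)

theorem synth_add (hF : ∀ γ, ‖F γ‖ ≤ 1) (ha : Summable fun γ => |a γ|)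
    (hb : Summable fun γ => |b γ|) : synth F (a + b) = synth F a + synth F b := by
  unfold synth
  rw [← (summable_norm_synth hF ha).of_norm.tsum_add (summable_norm_synth hF hb).of_norm]
  exact tsum_congr fun γ => add_smul (a γ) (b γ) (F γ)

theorem synth_smul (c : ℝ) (a : Γ → ℝ) : synth F (c • a) = c • synth F a := by
  simp [synth, ← tsum_const_smul'', mul_smul]

theorem synth_zero : synth F 0 = 0 := by simp [synth]

theorem tendsto_synth {ι : Type*} {l : Filter ι} (hF : ∀ γ, ‖F γ‖ ≤ 1) {b : ι → Γ → ℝ}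
    (ha : Summable fun γ => |a γ|) (hb : ∀ k, Summable fun γ => |b k γ|)
    (hab : Tendsto (fun k => ∑' γ, |b k γ - a γ|) l (𝓝 0)) :
    Tendsto (fun k => synth F (b k)) l (𝓝 (synth F a)) := by
  refine tendsto_iff_norm_sub_tendsto_zero.2
    (squeeze_zero (fun _ => norm_nonneg _) (fun k => ?_) hab)
  rw [← synth_sub hF (hb k) ha]
  exact norm_synth_le hF (summable_abs_sub (hb k) ha)

theorem continuousOn_synth_apply (hF : ∀ γ, ‖F γ‖ ≤ 1) {x : E}
    (hx : Tendsto (fun γ => F γ x) cofinite (𝓝 0)) :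
    ContinuousOn (fun a => synth F a x) (l1Ball Γ) := by
  refine continuousOn_of_uniform_approx_of_continuousOn fun u hu => ?_
  obtain ⟨ε, hε, hεu⟩ := Metric.mem_uniformity_dist.1 hu
  have hfin := tendsto_cofinite_zero_iff.1 hx (ε / 2) (half_pos hε)
  refine ⟨fun a => ∑ γ ∈ hfin.toFinset, a γ * F γ x, by fun_prop, fun a ha => hεu ?_⟩
  have hsa := summable_abs_of_mem_l1Ball ha
  have hsum := hasSum_synth_apply hF hsa x
  have hsc : Summable fun γ : ((hfin.toFinset : Set Γ)ᶜ : Set Γ) => |a γ| := hsa.subtype _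
  rw [← hsum.tsum_eq, ← hsum.summable.sum_add_tsum_compl (s := hfin.toFinset), dist_eq_norm,
    add_sub_cancel_left]
  calc ‖∑' γ : ((hfin.toFinset : Set Γ)ᶜ : Set Γ), a γ * F γ x‖
      ≤ ∑' γ : ((hfin.toFinset : Set Γ)ᶜ : Set Γ), |a γ| * (ε / 2) := by
        refine tsum_of_norm_bounded (hsc.mul_right _).hasSum fun γ => ?_
        have hγ : ‖F γ x‖ < ε / 2 := not_le.1 fun h => γ.2 (hfin.mem_toFinset.2 h)
        rw [norm_mul, Real.norm_eq_abs]
        gcongr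
    _ = (∑' γ : ((hfin.toFinset : Set Γ)ᶜ : Set Γ), |a γ|) * (ε / 2) := tsum_mul_right
    _ ≤ 1 * (ε / 2) := by
        gcongr
        exact (hsa.tsum_subtype_le _ _ (fun _ => abs_nonneg _)).trans
          (tsum_abs_le_of_mem_l1Ball ha)
    _ < ε := by linarith

end SummableFamilies

section GaugePenalty

variable {Γ : Type*} {E : Type*} [NormedAddCommGroup E] [NormedSpace ℝ E]
  {F : Γ → StrongDual ℝ E}

/-- The `n`-th term of the penalty, jointly convex in the functional `f` and the coefficients `a`.
It is small only if `f` is close to `n • synth F a` and `a` is small in `ℓ¹` and `ℓ²`. -/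
noncomputable def gaugeTerm (F : Γ → StrongDual ℝ E) (n : ℕ) (f : StrongDual ℝ E) (a : Γ → ℝ) :
    ℝ :=
  ‖f - (n : ℝ) • synth F a‖ ^ 2 + (∑' γ, |a γ|) ^ 2 + ∑' γ, a γ ^ 2

/-- A lower bound for the midpoint convexity gap of `gaugeTerm F n` between `(f, a)` and
`(g, b)`. -/
noncomputable def gaugeGap (F : Γ → StrongDual ℝ E) (n : ℕ) (f g : StrongDual ℝ E)
    (a b : Γ → ℝ) : ℝ :=
  ((‖f - (n : ℝ) • synth F a‖ - ‖g - (n : ℝ) • synth F b‖) ^ 2 +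
    (∑' γ, |a γ| - ∑' γ, |b γ|) ^ 2 + ∑' γ, (a γ - b γ) ^ 2) / 4

/-- The weights of the terms in `gaugePenalty`, small enough to make the series converge uniformly
on the product of the dual ball and of the `ℓ¹` balls. -/
noncomputable def gaugeWeight (n : ℕ) : ℝ := (1 / 2) ^ n / (((n : ℝ) + 1) ^ 2 + 2)

/-- The convex penalty attached to a functional `f` and to one family of coefficients for each
`n`. -/
noncomputable def gaugePenalty (F : Γ → StrongDual ℝ E) (f : StrongDual ℝ E) (a : ℕ → Γ → ℝ) : ℝ :=
  ∑' n, gaugeWeight n * gaugeTerm F n f (a n)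

theorem gaugeTerm_nonneg (n : ℕ) (f : StrongDual ℝ E) (a : Γ → ℝ) : 0 ≤ gaugeTerm F n f a := by
  have : 0 ≤ ∑' γ, a γ ^ 2 := tsum_nonneg fun _ => sq_nonneg _
  unfold gaugeTerm
  positivity

theorem sq_norm_sub_smul_synth_le_gaugeTerm (n : ℕ) (f : StrongDual ℝ E) (a : Γ → ℝ) :
    ‖f - (n : ℝ) • synth F a‖ ^ 2 ≤ gaugeTerm F n f a := by
  have : 0 ≤ ∑' γ, a γ ^ 2 := tsum_nonneg fun _ => sq_nonneg _
  linarith [gaugeTerm.eq_def F n f a, sq_nonneg (∑' γ, |a γ|)]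

theorem gaugeTerm_le (hF : ∀ γ, ‖F γ‖ ≤ 1) (n : ℕ) {f : StrongDual ℝ E} (hf : ‖f‖ ≤ 1)
    {a : Γ → ℝ} (ha : a ∈ l1Ball Γ) : gaugeTerm F n f a ≤ ((n : ℝ) + 1) ^ 2 + 2 := by
  have hsa := summable_abs_of_mem_l1Ball ha
  have hnorm : ‖f - (n : ℝ) • synth F a‖ ≤ n + 1 := by
    calc ‖f - (n : ℝ) • synth F a‖ ≤ ‖f‖ + n * ‖synth F a‖ := by
          simpa [norm_smul] using norm_sub_le f ((n : ℝ) • synth F a)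
      _ ≤ 1 + n * 1 := by
          gcongr
          exact (norm_synth_le hF hsa).trans (tsum_abs_le_of_mem_l1Ball ha)
      _ = n + 1 := by ring
  have hl1 : (∑' γ, |a γ|) ^ 2 ≤ 1 :=
    pow_le_one₀ (tsum_nonneg fun _ => abs_nonneg _) (tsum_abs_le_of_mem_l1Ball ha)
  have hl2 := tsum_sq_le_sq_tsum_abs hsa
  have hnorm_sq := pow_le_pow_left₀ (norm_nonneg _) hnorm 2
  unfold gaugeTerm
  linarith

theorem gaugeTerm_inv_smul_le {a : Γ → ℝ} (ha : Summable fun γ => |a γ|) (f : StrongDual ℝ E)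
    {n : ℕ} (hn : n ≠ 0) : gaugeTerm F n f ((n : ℝ)⁻¹ • a) ≤
      ‖f - synth F a‖ ^ 2 + 2 * ((n : ℝ)⁻¹ * ∑' γ, |a γ|) ^ 2 := by
  have habs (γ : Γ) : |((n : ℝ)⁻¹ • a) γ| = (n : ℝ)⁻¹ * |a γ| := by simp [abs_mul]
  have hsq := tsum_sq_le_sq_tsum_abs (a := (n : ℝ)⁻¹ • a) (by simpa only [habs] using ha.mul_left _)
  simp only [habs, tsum_mul_left] at hsq
  simp only [gaugeTerm, synth_smul, smul_inv_smul₀ (Nat.cast_ne_zero.2 hn : (n : ℝ) ≠ 0), habs,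
    tsum_mul_left]
  linarith

theorem norm_midpoint_sq_le {G : Type*} [NormedAddCommGroup G] [NormedSpace ℝ G] (u v : G) :
    ‖(2⁻¹ : ℝ) • (u + v)‖ ^ 2 + (‖u‖ - ‖v‖) ^ 2 / 4 ≤ (‖u‖ ^ 2 + ‖v‖ ^ 2) / 2 := by
  have h : ‖(2⁻¹ : ℝ) • (u + v)‖ ≤ (‖u‖ + ‖v‖) / 2 := by
    rw [norm_smul, norm_inv, Real.norm_ofNat]
    linarith [norm_add_le u v]
  linarith [pow_le_pow_left₀ (norm_nonneg _) h 2]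

theorem gaugeTerm_midpoint_le (hF : ∀ γ, ‖F γ‖ ≤ 1) (n : ℕ) (f g : StrongDual ℝ E) {a b : Γ → ℝ}
    (ha : Summable fun γ => |a γ|) (hb : Summable fun γ => |b γ|) :
    gaugeTerm F n ((2⁻¹ : ℝ) • (f + g)) ((2⁻¹ : ℝ) • (a + b)) + gaugeGap F n f g a b ≤
      (gaugeTerm F n f a + gaugeTerm F n g b) / 2 := by
  have hnorm := norm_midpoint_sq_le (f - (n : ℝ) • synth F a) (g - (n : ℝ) • synth F b)
  have hmid : (2⁻¹ : ℝ) • (f + g) - (n : ℝ) • synth F ((2⁻¹ : ℝ) • (a + b)) =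
      (2⁻¹ : ℝ) • ((f - (n : ℝ) • synth F a) + (g - (n : ℝ) • synth F b)) := by
    rw [synth_smul, synth_add hF ha hb]
    module
  have hl1 := pow_le_pow_left₀ (tsum_nonneg fun _ => abs_nonneg _) (tsum_abs_midpoint_le ha hb) 2
  have hl2 := tsum_sq_midpoint_add (summable_sq_of_summable_abs ha)
    (summable_sq_of_summable_abs hb) (summable_sq_of_summable_abs (summable_abs_sub ha hb))
  unfold gaugeTerm gaugeGap
  rw [hmid]
  linarith

theorem gaugeGap_nonneg (n : ℕ) (f g : StrongDual ℝ E) (a b : Γ → ℝ) :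
    0 ≤ gaugeGap F n f g a b := by
  have : 0 ≤ ∑' γ, (a γ - b γ) ^ 2 := tsum_nonneg fun _ => sq_nonneg _
  unfold gaugeGap
  positivity

theorem gaugeWeight_pos (n : ℕ) : 0 < gaugeWeight n := by unfold gaugeWeight; positivity

theorem gaugeWeight_le (n : ℕ) : gaugeWeight n ≤ (1 / 2) ^ n :=
  div_le_self (by positivity) (by linarith [sq_nonneg ((n : ℝ) + 1)])

theorem gaugeWeight_mul_gaugeTerm_nonneg (n : ℕ) (f : StrongDual ℝ E) (a : Γ → ℝ) :
    0 ≤ gaugeWeight n * gaugeTerm F n f a :=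
  mul_nonneg (gaugeWeight_pos n).le (gaugeTerm_nonneg n f a)

theorem gaugePenalty_nonneg (f : StrongDual ℝ E) (a : ℕ → Γ → ℝ) : 0 ≤ gaugePenalty F f a :=
  tsum_nonneg fun n => gaugeWeight_mul_gaugeTerm_nonneg n f (a n)

theorem summable_gaugePenalty (hF : ∀ γ, ‖F γ‖ ≤ 1) {f : StrongDual ℝ E} (hf : ‖f‖ ≤ 1)
    {a : ℕ → Γ → ℝ} (ha : ∀ n, a n ∈ l1Ball Γ) :
    Summable fun n => gaugeWeight n * gaugeTerm F n f (a n) := by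
  refine summable_geometric_two.of_nonneg_of_le
    (fun n => gaugeWeight_mul_gaugeTerm_nonneg n f (a n)) fun n => ?_
  rw [gaugeWeight, div_mul_eq_mul_div, div_le_iff₀ (by positivity)]
  gcongr
  exact gaugeTerm_le hF n hf (ha n)

theorem gaugePenalty_zero_right_le (f : StrongDual ℝ E) : gaugePenalty F f 0 ≤ 2 * ‖f‖ ^ 2 := by
  have hle (n : ℕ) : gaugeWeight n * gaugeTerm F n f 0 ≤ (1 / 2) ^ n * ‖f‖ ^ 2 := by
    have : gaugeTerm F n f 0 = ‖f‖ ^ 2 := by simp [gaugeTerm, synth_zero]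
    rw [this]
    gcongr
    exact gaugeWeight_le n
  have hs : Summable fun n : ℕ => (1 / 2 : ℝ) ^ n * ‖f‖ ^ 2 := summable_geometric_two.mul_right _
  calc gaugePenalty F f 0 ≤ ∑' n : ℕ, (1 / 2 : ℝ) ^ n * ‖f‖ ^ 2 :=
        (hs.of_nonneg_of_le (fun n => gaugeWeight_mul_gaugeTerm_nonneg n f 0) hle).tsum_le_tsum
          hle hs
    _ = 2 * ‖f‖ ^ 2 := by rw [tsum_mul_right, tsum_geometric_two]

theorem norm_midpoint_le_one {f g : StrongDual ℝ E} (hf : ‖f‖ ≤ 1) (hg : ‖g‖ ≤ 1) :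
    ‖(2⁻¹ : ℝ) • (f + g)‖ ≤ 1 := by
  rw [norm_smul, norm_inv, Real.norm_ofNat]
  linarith [norm_add_le f g]

theorem gaugePenalty_midpoint_le (hF : ∀ γ, ‖F γ‖ ≤ 1) {f g : StrongDual ℝ E} (hf : ‖f‖ ≤ 1)
    (hg : ‖g‖ ≤ 1) {a b : ℕ → Γ → ℝ} (ha : ∀ n, a n ∈ l1Ball Γ) (hb : ∀ n, b n ∈ l1Ball Γ) (n : ℕ) :
    gaugePenalty F ((2⁻¹ : ℝ) • (f + g)) (fun m => (2⁻¹ : ℝ) • (a m + b m)) +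
        gaugeWeight n * gaugeGap F n f g (a n) (b n) ≤
      (gaugePenalty F f a + gaugePenalty F g b) / 2 := by
  have hsf := summable_gaugePenalty hF hf ha
  have hsg := summable_gaugePenalty hF hg hb
  have hsm := summable_gaugePenalty hF (norm_midpoint_le_one hf hg)
    fun m => midpoint_mem_l1Ball (ha m) (hb m)
  have hsd := ((hsf.add hsg).div_const 2).sub hsm
  have hgap (m : ℕ) : gaugeWeight m * gaugeGap F m f g (a m) (b m) ≤
      (gaugeWeight m * gaugeTerm F m f (a m) + gaugeWeight m * gaugeTerm F m g (b m)) / 2 -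
        gaugeWeight m * gaugeTerm F m ((2⁻¹ : ℝ) • (f + g)) ((2⁻¹ : ℝ) • (a m + b m)) := by
    have := mul_le_mul_of_nonneg_left (gaugeTerm_midpoint_le hF m f g
      (summable_abs_of_mem_l1Ball (ha m)) (summable_abs_of_mem_l1Ball (hb m)))
      (gaugeWeight_pos m).le
    linarith
  have hle := (hgap n).trans (hsd.le_tsum n fun m _ =>
    (mul_nonneg (gaugeWeight_pos m).le (gaugeGap_nonneg m f g _ _)).trans (hgap m))
  rw [((hsf.add hsg).div_const 2).tsum_sub hsm, tsum_div_const, hsf.tsum_add hsg] at hle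
  unfold gaugePenalty
  linarith

theorem lowerSemicontinuousOn_gaugeTerm (hF : ∀ γ, ‖F γ‖ ≤ 1)
    (hF0 : ∀ x, Tendsto (fun γ => F γ x) cofinite (𝓝 0)) {X : Type*} [TopologicalSpace X]
    {K : Set X} {f : X → StrongDual ℝ E} {a : X → Γ → ℝ}
    (hf : ∀ x, ContinuousOn (fun p => f p x) K) (ha : ContinuousOn a K)
    (hmem : Set.MapsTo a K (l1Ball Γ)) (n : ℕ) :
    LowerSemicontinuousOn (fun p => gaugeTerm F n (f p) (a p)) K := by
  have hsum (p) (hp : p ∈ K) := summable_abs_of_mem_l1Ball (hmem hp)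
  have hcoord := continuousOn_pi.1 ha
  have hdist : LowerSemicontinuousOn (fun p => ‖f p - (n : ℝ) • synth F (a p)‖) K :=
    lowerSemicontinuousOn_norm_of_continuousOn_apply fun x => (hf x).sub
      (((continuousOn_synth_apply hF (hF0 x)).comp ha hmem).const_smul (n : ℝ))
  have hl1 : LowerSemicontinuousOn (fun p => ∑' γ, |a p γ|) K :=
    lowerSemicontinuousOn_tsum_of_nonneg (fun _ _ _ => abs_nonneg _) hsum
      fun γ => (hcoord γ).abs.lowerSemicontinuousOn
  have hl2 : LowerSemicontinuousOn (fun p => ∑' γ, a p γ ^ 2) K :=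
    lowerSemicontinuousOn_tsum_of_nonneg (fun _ _ _ => sq_nonneg _)
      (fun p hp => summable_sq_of_summable_abs (hsum p hp))
      fun γ => ((hcoord γ).pow 2).lowerSemicontinuousOn
  exact ((lowerSemicontinuousOn_sq_of_nonneg hdist fun _ _ => norm_nonneg _).add
    (lowerSemicontinuousOn_sq_of_nonneg hl1 fun _ _ => tsum_nonneg fun _ => abs_nonneg _)).add hl2

theorem lowerSemicontinuousOn_gaugePenalty (hF : ∀ γ, ‖F γ‖ ≤ 1)
    (hF0 : ∀ x, Tendsto (fun γ => F γ x) cofinite (𝓝 0)) :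
    LowerSemicontinuousOn
      (fun p : WeakDual ℝ E × (ℕ → Γ → ℝ) => gaugePenalty F (WeakDual.toStrongDual p.1) p.2)
      ((WeakDual.toStrongDual ⁻¹' Metric.closedBall (0 : StrongDual ℝ E) 1) ×ˢ
        Set.pi Set.univ fun _ => l1Ball Γ) := by
  refine lowerSemicontinuousOn_tsum_of_nonneg
    (fun n p _ => gaugeWeight_mul_gaugeTerm_nonneg n _ _)
    (fun p hp => summable_gaugePenalty hF (by simpa using hp.1) fun n => hp.2 n trivial) fun n => ?_
  have hterm := lowerSemicontinuousOn_gaugeTerm hF hF0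
    (K := (WeakDual.toStrongDual ⁻¹' Metric.closedBall (0 : StrongDual ℝ E) 1) ×ˢ
      Set.pi Set.univ fun _ : ℕ => l1Ball Γ)
    (f := fun p : WeakDual ℝ E × (ℕ → Γ → ℝ) => WeakDual.toStrongDual p.1) (a := fun p => p.2 n)
    (fun x => ((WeakDual.eval_continuous x).comp continuous_fst).continuousOn)
    (by fun_prop) (fun p hp => hp.2 n trivial) n
  exact (continuous_const_mul (gaugeWeight n)).comp_lowerSemicontinuousOn hterm
    fun u v huv => mul_le_mul_of_nonneg_left huv (gaugeWeight_pos n).le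

end GaugePenalty

section GaugeMinimizer

variable {Γ : Type*} {E : Type*} [NormedAddCommGroup E] [NormedSpace ℝ E]
  {F : Γ → StrongDual ℝ E}

/-- `(f, a)` minimizes `gaugePenalty F g b - g x` among the pairs `(g, b)` with `g` in the dual unit
ball and each `b n` in the unit ball of `ℓ¹`. The minimizer `f` at `x` will be the derivative at `x`
of the smooth gauge. -/
structure IsGaugeMinimizer (F : Γ → StrongDual ℝ E) (x : E) (f : StrongDual ℝ E)
    (a : ℕ → Γ → ℝ) : Prop where
  norm_le_one : ‖f‖ ≤ 1
  mem_l1Ball : ∀ n, a n ∈ l1Ball Γ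
  le : ∀ (g : StrongDual ℝ E) (b : ℕ → Γ → ℝ), ‖g‖ ≤ 1 → (∀ n, b n ∈ l1Ball Γ) →
    gaugePenalty F f a - f x ≤ gaugePenalty F g b - g x

theorem exists_isGaugeMinimizer (hF : ∀ γ, ‖F γ‖ ≤ 1)
    (hF0 : ∀ x, Tendsto (fun γ => F γ x) cofinite (𝓝 0)) (x : E) :
    ∃ f a, IsGaugeMinimizer F x f a := by
  have hK : IsCompact ((WeakDual.toStrongDual ⁻¹' Metric.closedBall (0 : StrongDual ℝ E) 1) ×ˢ
      Set.pi Set.univ fun _ : ℕ => l1Ball Γ) :=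
    (WeakDual.isCompact_closedBall _ _).prod (isCompact_univ_pi fun _ => isCompact_l1Ball)
  have hne : ((WeakDual.toStrongDual ⁻¹' Metric.closedBall (0 : StrongDual ℝ E) 1) ×ˢ
      Set.pi Set.univ fun _ : ℕ => l1Ball Γ).Nonempty :=
    ⟨(0, 0), by simp, fun _ _ => zero_mem_l1Ball⟩
  have heval : Continuous fun p : WeakDual ℝ E × (ℕ → Γ → ℝ) => -p.1 x :=
    ((WeakDual.eval_continuous x).comp continuous_fst).neg
  obtain ⟨p, hp, hmin⟩ := ((lowerSemicontinuousOn_gaugePenalty hF hF0).add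
    (heval.lowerSemicontinuous.lowerSemicontinuousOn _)).exists_isMinOn hne hK
  refine ⟨WeakDual.toStrongDual p.1, p.2, by simpa using hp.1, fun n => hp.2 n trivial,
    fun g b hg hb => ?_⟩
  have := hmin (show (StrongDual.toWeakDual g, b) ∈ _ from ⟨by simpa using hg, fun n _ => hb n⟩)
  simpa [sub_eq_add_neg] using this

theorem IsReflexiveSpace.topologicalClosure_span_eq_top (hE : IsReflexiveSpace E)
    (hF : ∀ x, (∀ γ, F γ x = 0) → x = 0) :
    (Submodule.span ℝ (Set.range F)).topologicalClosure = ⊤ := by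
  refine eq_top_of_dual_eq_zero (Submodule.isClosed_topologicalClosure _) fun Ξ hΞ => ?_
  obtain ⟨x, rfl⟩ := hE Ξ
  have : x = 0 := hF x fun γ => by
    simpa using hΞ (F γ) (subset_closure (Submodule.subset_span ⟨γ, rfl⟩))
  rw [this, map_zero]

theorem IsReflexiveSpace.exists_norm_sub_synth_lt (hE : IsReflexiveSpace E)
    (hF : ∀ x, (∀ γ, F γ x = 0) → x = 0) (f : StrongDual ℝ E) {ε : ℝ} (hε : 0 < ε) :
    ∃ c : Γ →₀ ℝ, ‖f - synth F c‖ < ε := by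
  have hf : f ∈ (Submodule.span ℝ (Set.range F)).topologicalClosure :=
    hE.topologicalClosure_span_eq_top hF ▸ Submodule.mem_top
  obtain ⟨g, hg, hfg⟩ := Metric.mem_closure_iff.1 hf ε hε
  obtain ⟨c, rfl⟩ := Finsupp.mem_span_range_iff_exists_finsupp.1 hg
  have hsynth : synth F c = c.sum fun γ t => t • F γ :=
    tsum_eq_sum fun γ hγ => by rw [Finsupp.notMem_support_iff.1 hγ, zero_smul]
  exact ⟨c, by rwa [hsynth, ← dist_eq_norm]⟩

theorem IsReflexiveSpace.exists_gaugeTerm_lt (hE : IsReflexiveSpace E)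
    (hF : ∀ x, (∀ γ, F γ x = 0) → x = 0) (f : StrongDual ℝ E) {ε : ℝ} (hε : 0 < ε) :
    ∃ n, ∃ b ∈ l1Ball Γ, gaugeTerm F n f b < ε ^ 2 := by
  obtain ⟨c, hc⟩ := hE.exists_norm_sub_synth_lt hF f hε
  have hs : Summable fun γ => |c γ| :=
    summable_of_ne_finset_zero (s := c.support) fun γ hγ => by
      simp [Finsupp.notMem_support_iff.1 hγ]
  have hscaled : Tendsto (fun n : ℕ => (n : ℝ)⁻¹ * ∑' γ, |c γ|) atTop (𝓝 0) := by
    simpa using tendsto_inv_atTop_nhds_zero_nat.mul_const (∑' γ, |c γ|)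
  have hbound : Tendsto
      (fun n : ℕ => ‖f - synth F c‖ ^ 2 + 2 * ((n : ℝ)⁻¹ * ∑' γ, |c γ|) ^ 2) atTop
      (𝓝 (‖f - synth F c‖ ^ 2)) := by
    simpa using ((hscaled.pow 2).const_mul 2).const_add (‖f - synth F c‖ ^ 2)
  obtain ⟨n, hn1, hnε, hn0⟩ := ((hscaled.eventually_le_const one_pos).and
    ((hbound.eventually_lt_const (show _ < ε ^ 2 by gcongr)).and (eventually_ne_atTop 0))).exists
  have habs (γ : Γ) : |((n : ℝ)⁻¹ • (c : Γ → ℝ)) γ| = (n : ℝ)⁻¹ * |c γ| := by simp [abs_mul]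
  refine ⟨n, (n : ℝ)⁻¹ • c, mem_l1Ball_of_tsum_abs_le ?_ ?_,
    (gaugeTerm_inv_smul_le hs f hn0).trans_lt hnε⟩
  · simpa only [habs] using hs.mul_left _
  · simpa only [habs, tsum_mul_left] using hn1

namespace IsGaugeMinimizer

variable {x y : E} {f g : StrongDual ℝ E} {a b : ℕ → Γ → ℝ}

theorem apply_sub_le (hf : IsGaugeMinimizer F x f a) (hg : IsGaugeMinimizer F y g b) :
    g (x - y) ≤ (f x - gaugePenalty F f a) - (g y - gaugePenalty F g b) := by
  have := hf.le g b hg.norm_le_one hg.mem_l1Ball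
  rw [map_sub]
  linarith

theorem gaugeTerm_le (h : IsGaugeMinimizer F x f a) (hF : ∀ γ, ‖F γ‖ ≤ 1) (n : ℕ) {b : Γ → ℝ}
    (hb : b ∈ l1Ball Γ) : gaugeTerm F n f (a n) ≤ gaugeTerm F n f b := by
  classical
  by_contra! hlt
  have hmem (m : ℕ) : Function.update a n b m ∈ l1Ball Γ := by
    rcases eq_or_ne m n with rfl | hmn
    · simpa using hb
    · simpa [hmn] using h.mem_l1Ball m
  have hpenalty : gaugePenalty F f (Function.update a n b) < gaugePenalty F f a := by
    refine Summable.tsum_lt_tsum (i := n) (fun m => ?_) ?_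
      (summable_gaugePenalty hF h.norm_le_one hmem)
      (summable_gaugePenalty hF h.norm_le_one h.mem_l1Ball)
    · rcases eq_or_ne m n with rfl | hmn
      · simpa using mul_le_mul_of_nonneg_left hlt.le (gaugeWeight_pos m).le
      · simp [hmn]
    · simpa using mul_lt_mul_of_pos_left hlt (gaugeWeight_pos n)
  linarith [h.le f _ h.norm_le_one hmem]

theorem exists_norm_sub_smul_synth_lt (h : IsGaugeMinimizer F x f a) (hE : IsReflexiveSpace E)
    (hF : IsTotalNullFamily F ⊤) {ε : ℝ} (hε : 0 < ε) :
    ∃ n : ℕ, ‖f - (n : ℝ) • synth F (a n)‖ < ε := by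
  obtain ⟨n, b, hb, hbε⟩ := hE.exists_gaugeTerm_lt (fun x => hF.eq_zero x trivial) f hε
  exact ⟨n, lt_of_pow_lt_pow_left₀ 2 hε.le ((sq_norm_sub_smul_synth_le_gaugeTerm n f _).trans_lt
    ((h.gaugeTerm_le hF.norm_le_one n hb).trans_lt hbε))⟩

/- Compare both minimizers with their midpoint and add the two inequalities. -/
theorem gaugeWeight_mul_gaugeGap_le (hf : IsGaugeMinimizer F x f a)
    (hg : IsGaugeMinimizer F y g b) (hF : ∀ γ, ‖F γ‖ ≤ 1) (n : ℕ) :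
    gaugeWeight n * gaugeGap F n f g (a n) (b n) ≤ ‖x - y‖ / 2 := by
  have hmid := norm_midpoint_le_one hf.norm_le_one hg.norm_le_one
  have hmem (m : ℕ) := midpoint_mem_l1Ball (hf.mem_l1Ball m) (hg.mem_l1Ball m)
  have hx := hf.le _ _ hmid hmem
  have hy := hg.le _ _ hmid hmem
  have hgap := gaugePenalty_midpoint_le hF hf.norm_le_one hg.norm_le_one hf.mem_l1Ball
    hg.mem_l1Ball n
  have hmono : (f - g) (x - y) ≤ 2 * ‖x - y‖ :=
    (le_abs_self _).trans ((f - g).le_of_opNorm_le ((norm_sub_le f g).trans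
      (by linarith [hf.norm_le_one, hg.norm_le_one])) _)
  simp only [smul_apply, add_apply, sub_apply, smul_eq_mul, map_sub] at hx hy hmono
  linarith

end IsGaugeMinimizer

theorem tendsto_zero_of_sq_le {ι : Type*} {l : Filter ι} {s d : ι → ℝ} (h : ∀ k, s k ^ 2 ≤ d k)
    (hd : Tendsto d l (𝓝 0)) : Tendsto s l (𝓝 0) :=
  squeeze_zero_norm (fun k => Real.abs_le_sqrt (h k)) (by simpa using hd.sqrt)

theorem tendsto_synth_of_gaugeGap {ι : Type*} {l : Filter ι} (hF : ∀ γ, ‖F γ‖ ≤ 1) {n : ℕ}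
    {f : StrongDual ℝ E} {g : ι → StrongDual ℝ E} {a : Γ → ℝ} {b : ι → Γ → ℝ}
    (ha : Summable fun γ => |a γ|) (hb : ∀ k, Summable fun γ => |b k γ|)
    (h : Tendsto (fun k => gaugeGap F n f (g k) a (b k)) l (𝓝 0)) :
    Tendsto (fun k => synth F (b k)) l (𝓝 (synth F a)) ∧
      Tendsto (fun k => ‖g k - (n : ℝ) • synth F (b k)‖) l (𝓝 ‖f - (n : ℝ) • synth F a‖) := by
  have hgap4 : Tendsto (fun k => 4 * gaugeGap F n f (g k) a (b k)) l (𝓝 0) := by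
    simpa using h.const_mul 4
  have hexpand (k) : 4 * gaugeGap F n f (g k) a (b k) =
      (‖f - (n : ℝ) • synth F a‖ - ‖g k - (n : ℝ) • synth F (b k)‖) ^ 2 +
        (∑' γ, |a γ| - ∑' γ, |b k γ|) ^ 2 + ∑' γ, (a γ - b k γ) ^ 2 := by
    unfold gaugeGap
    ring
  have hsq (k) : Summable fun γ => (a γ - b k γ) ^ 2 :=
    summable_sq_of_summable_abs (summable_abs_sub ha (hb k))
  have hsq0 (k) : 0 ≤ ∑' γ, (a γ - b k γ) ^ 2 := tsum_nonneg fun _ => sq_nonneg _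
  have hsq_norm (k) := sq_nonneg
    (‖f - (n : ℝ) • synth F a‖ - ‖g k - (n : ℝ) • synth F (b k)‖)
  have hsq_l1 (k) := sq_nonneg (∑' γ, |a γ| - ∑' γ, |b k γ|)
  have hnorm : Tendsto (fun k => ‖f - (n : ℝ) • synth F a‖ - ‖g k - (n : ℝ) • synth F (b k)‖) l
      (𝓝 0) :=
    tendsto_zero_of_sq_le (fun k => by linarith [hexpand k, hsq0 k, hsq_l1 k]) hgap4
  have hl1 : Tendsto (fun k => ∑' γ, |a γ| - ∑' γ, |b k γ|) l (𝓝 0) :=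
    tendsto_zero_of_sq_le (fun k => by linarith [hexpand k, hsq0 k, hsq_norm k]) hgap4
  have hcoord (γ : Γ) : Tendsto (fun k => a γ - b k γ) l (𝓝 0) :=
    tendsto_zero_of_sq_le (fun k => by
      linarith [hexpand k, hsq_norm k, hsq_l1 k, (hsq k).le_tsum γ fun _ _ => sq_nonneg _]) hgap4
  refine ⟨tendsto_synth hF ha hb (tendsto_tsum_abs_sub ha hb (fun γ => ?_) ?_), ?_⟩
  · simpa using (hcoord γ).const_sub (a γ)
  · simpa using hl1.const_sub (∑' γ, |a γ|)
  · simpa using hnorm.const_sub ‖f - (n : ℝ) • synth F a‖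

theorem IsReflexiveSpace.continuous_of_isGaugeMinimizer (hE : IsReflexiveSpace E)
    (hF : IsTotalNullFamily F ⊤) {f : E → StrongDual ℝ E} {a : E → ℕ → Γ → ℝ}
    (h : ∀ x, IsGaugeMinimizer F x (f x) (a x)) : Continuous f := by
  refine continuous_iff_continuousAt.2 fun x => Metric.tendsto_nhds.2 fun ε hε => ?_
  obtain ⟨n, hn⟩ := (h x).exists_norm_sub_smul_synth_lt hE hF (half_pos hε)
  have hgap : Tendsto (fun y => gaugeGap F n (f x) (f y) (a x n) (a y n)) (𝓝 x) (𝓝 0) := by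
    refine squeeze_zero (fun y => gaugeGap_nonneg _ _ _ _ _)
      (fun y => (le_div_iff₀' (gaugeWeight_pos n)).2
        ((h x).gaugeWeight_mul_gaugeGap_le (h y) hF.norm_le_one n)) ?_
    have : Continuous fun y => ‖x - y‖ / 2 / gaugeWeight n := by fun_prop
    simpa using this.tendsto x
  obtain ⟨hsynth, hnorm⟩ := tendsto_synth_of_gaugeGap hF.norm_le_one
    (summable_abs_of_mem_l1Ball ((h x).mem_l1Ball n))
    (fun y => summable_abs_of_mem_l1Ball ((h y).mem_l1Ball n)) hgap
  have hbound : Tendsto (fun y => ‖f y - (n : ℝ) • synth F (a y n)‖ +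
      ‖(n : ℝ) • (synth F (a y n) - synth F (a x n))‖ + ‖f x - (n : ℝ) • synth F (a x n)‖) (𝓝 x)
      (𝓝 (‖f x - (n : ℝ) • synth F (a x n)‖ + ‖f x - (n : ℝ) • synth F (a x n)‖)) := by
    simpa using (hnorm.add ((hsynth.sub_const (synth F (a x n))).const_smul (n : ℝ)).norm).add_const
      ‖f x - (n : ℝ) • synth F (a x n)‖
  filter_upwards [hbound.eventually_lt_const (show _ < ε by linarith)] with y hy
  calc dist (f y) (f x)
      = ‖(f y - (n : ℝ) • synth F (a y n)) + (n : ℝ) • (synth F (a y n) - synth F (a x n)) -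
          (f x - (n : ℝ) • synth F (a x n))‖ := by rw [dist_eq_norm]; congr 1; module
    _ ≤ ‖f y - (n : ℝ) • synth F (a y n)‖ + ‖(n : ℝ) • (synth F (a y n) - synth F (a x n))‖ +
          ‖f x - (n : ℝ) • synth F (a x n)‖ :=
        (norm_sub_le _ _).trans (by gcongr; exact norm_add_le _ _)
    _ < ε := hy

end GaugeMinimizer

section SmoothGauge

variable {E : Type*} [NormedAddCommGroup E] [NormedSpace ℝ E]

theorem hasFDerivAt_of_continuousAt_subgradient {θ : E → ℝ} {f : E → StrongDual ℝ E}
    (h : ∀ x y, f y (x - y) ≤ θ x - θ y) {x : E} (hf : ContinuousAt f x) :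
    HasFDerivAt θ (f x) x := by
  rw [hasFDerivAt_iff_isLittleO, Asymptotics.isLittleO_iff]
  intro c hc
  filter_upwards [Metric.continuousAt_iff'.1 hf c hc] with y hy
  have hle : (f y - f x) (y - x) ≤ c * ‖y - x‖ :=
    (le_abs_self _).trans ((f y - f x).le_of_opNorm_le (dist_eq_norm (f y) (f x) ▸ hy.le) _)
  have hneg : f y (x - y) = -f y (y - x) := by rw [← map_neg, neg_sub]
  rw [sub_apply] at hle
  rw [Real.norm_eq_abs, abs_of_nonneg (by linarith [h y x])]
  linarith [h x y]

/-- A convex `C¹` function with derivative bounded by `1` that replaces the norm in smooth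
variational arguments: optimizing `growth` over `s`, it is bounded below by `‖x‖ ^ 2 / 8` for
`‖x‖ ≤ 4` and by `‖x‖ - 2` for `‖x‖ ≥ 4`. -/
structure IsSmoothGauge (θ : E → ℝ) : Prop where
  contDiff : ContDiff ℝ 1 θ
  map_zero : θ 0 = 0
  nonneg : ∀ x, 0 ≤ θ x
  norm_fderiv_le_one : ∀ x, ‖fderiv ℝ θ x‖ ≤ 1
  fderiv_apply_sub_le : ∀ x y, fderiv ℝ θ y (x - y) ≤ θ x - θ y
  growth : ∀ x s, 0 ≤ s → s ≤ 1 → s * ‖x‖ - 2 * s ^ 2 ≤ θ x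

theorem IsReflexiveSpace.exists_isSmoothGauge [CompleteSpace E] (hE : IsReflexiveSpace E) :
    ∃ θ : E → ℝ, IsSmoothGauge θ := by
  obtain ⟨Γ, F, hF⟩ := hE.exists_isTotalNullFamily
  choose f a hfa using exists_isGaugeMinimizer hF.norm_le_one hF.tendsto_zero
  let θ : E → ℝ := fun x => f x x - gaugePenalty F (f x) (a x)
  have hsub (x y : E) : f y (x - y) ≤ θ x - θ y := (hfa x).apply_sub_le (hfa y)
  have hcont : Continuous f := hE.continuous_of_isGaugeMinimizer hF hfa
  have hderiv (x : E) : HasFDerivAt θ (f x) x :=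
    hasFDerivAt_of_continuousAt_subgradient hsub hcont.continuousAt
  have hfderiv : fderiv ℝ θ = f := funext fun x => (hderiv x).fderiv
  have hge (x : E) (g : StrongDual ℝ E) (hg : ‖g‖ ≤ 1) : g x - 2 * ‖g‖ ^ 2 ≤ θ x := by
    have hmin := (hfa x).le g 0 hg fun _ => zero_mem_l1Ball
    have hpenalty := gaugePenalty_zero_right_le (F := F) g
    simp only [θ]
    linarith
  have hnonneg (x : E) : 0 ≤ θ x := by simpa using hge x 0 (by simp)
  refine ⟨θ, ?_, (hnonneg 0).antisymm' ?_, hnonneg, ?_, ?_, fun x s hs0 hs1 => ?_⟩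
  · rw [contDiff_one_iff_fderiv, hfderiv]
    exact ⟨fun x => (hderiv x).differentiableAt, hcont⟩
  · simpa [θ] using gaugePenalty_nonneg (f 0) (a 0)
  · exact fun x => hfderiv ▸ (hfa x).norm_le_one
  · exact hfderiv ▸ hsub
  · have hnorm : ‖s • normingFunctional x‖ ≤ s := by
      rw [norm_smul, Real.norm_of_nonneg hs0]
      exact mul_le_of_le_one_right hs0 (norm_normingFunctional_le x)
    have hs := hge x (s • normingFunctional x) (hnorm.trans hs1)
    rw [smul_apply, normingFunctional_apply_self, smul_eq_mul] at hs
    linarith [pow_le_pow_left₀ (norm_nonneg _) hnorm 2]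

end SmoothGauge

/-! ### A multidirectional mean value inequality -/

section VariationalPrinciple

variable {X : Type*} {f : X → ℝ} {ρ : ℕ → X → X → ℝ}

/-- The function `f` penalized for the distance, measured by the gauges `ρ i`, to the first `n`
terms of the sequence `u`. -/
def partialPerturbation (f : X → ℝ) (ρ : ℕ → X → X → ℝ) (u : ℕ → X) (n : ℕ) (x : X) : ℝ :=
  f x + ∑ i ∈ Finset.range n, ρ i x (u i)

theorem partialPerturbation_succ (u : ℕ → X) (n : ℕ) (x : X) :
    partialPerturbation f ρ u (n + 1) x = partialPerturbation f ρ u n x + ρ n x (u n) := by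
  rw [partialPerturbation, Finset.sum_range_succ, ← add_assoc, partialPerturbation]

theorem monotone_partialPerturbation (hρ : ∀ i x y, 0 ≤ ρ i x y) (u : ℕ → X) (x : X) :
    Monotone fun n => partialPerturbation f ρ u n x :=
  monotone_nat_of_le_succ fun n => by
    rw [partialPerturbation_succ]
    exact le_add_of_nonneg_right (hρ n x (u n))

theorem tendsto_partialPerturbation {u : ℕ → X} {x : X} (h : Summable fun i => ρ i x (u i)) :
    Tendsto (fun n => partialPerturbation f ρ u n x) atTop (𝓝 (f x + ∑' i, ρ i x (u i))) :=
  h.hasSum.tendsto_sum_nat.const_add (f x)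

theorem exists_near_minimizer {h : X → ℝ} (hb : BddBelow (Set.range h)) (x : X) {η : ℝ}
    (hη : 0 < η) : ∃ y, h y ≤ h x ∧ ∀ z, h y ≤ h z + η := by
  obtain ⟨_, ⟨y, rfl⟩, hy⟩ :=
    exists_lt_of_csInf_lt (Set.range_nonempty_iff_nonempty.2 ⟨x⟩)
      (lt_add_of_pos_right (sInf (Set.range h)) hη)
  have hinf (z : X) : sInf (Set.range h) ≤ h z := csInf_le hb ⟨z, rfl⟩
  rcases le_total (h y) (h x) with hyx | hxy
  · exact ⟨y, hyx, fun z => by linarith [hinf z]⟩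
  · exact ⟨x, le_rfl, fun z => by linarith [hinf z]⟩

theorem exists_seq_near_minimizer (hb : BddBelow (Set.range f)) (hρ : ∀ i x y, 0 ≤ ρ i x y)
    {η : ℕ → ℝ} (hη : ∀ i, 0 < η i) (x₀ : X) :
    ∃ u : ℕ → X, f (u 0) ≤ f x₀ ∧
      (∀ i, partialPerturbation f ρ u (i + 1) (u (i + 1)) ≤
        partialPerturbation f ρ u (i + 1) (u i)) ∧
      ∀ i z, partialPerturbation f ρ u i (u i) ≤ partialPerturbation f ρ u i z + η i := by
  choose next hnext_le hnext_near using fun (h : {h : X → ℝ // BddBelow (Set.range h)}) (x : X)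
    (i : ℕ) => exists_near_minimizer h.2 x (hη i)
  have hbdd (h : {h : X → ℝ // BddBelow (Set.range h)}) (i : ℕ) (y : X) :
      BddBelow (Set.range fun x => h.1 x + ρ i x y) :=
    let ⟨m, hm⟩ := h.2
    ⟨m, Set.forall_mem_range.2 fun x =>
      le_add_of_le_of_nonneg (hm (Set.mem_range_self x)) (hρ i x y)⟩
  let perturb (i : ℕ) (p : {h : X → ℝ // BddBelow (Set.range h)} × X) :
    {h : X → ℝ // BddBelow (Set.range h)} := ⟨fun x => p.1.1 x + ρ i x p.2, hbdd p.1 i p.2⟩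
  let state (n : ℕ) : {h : X → ℝ // BddBelow (Set.range h)} × X :=
    Nat.rec (⟨f, hb⟩, next ⟨f, hb⟩ x₀ 0)
      (fun i p => (perturb i p, next (perturb i p) p.2 (i + 1))) n
  let u (n : ℕ) : X := (state n).2
  have hstate (n : ℕ) : (state n).1.1 = partialPerturbation f ρ u n := by
    induction n with
    | zero => simp [state, funext_iff, partialPerturbation]
    | succ n ih =>
      ext x
      rw [partialPerturbation_succ, ← ih]
  refine ⟨u, hnext_le ⟨f, hb⟩ x₀ 0, fun i => ?_, fun i z => ?_⟩
  · rw [← hstate]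
    exact hnext_le _ _ _
  · rw [← hstate]
    cases i <;> exact hnext_near _ _ _ _

/- The smooth variational principle of Borwein and Preiss, for a sequence of gauges. -/
theorem exists_forall_add_tsum_le [PseudoMetricSpace X] [CompleteSpace X]
    (hf : LowerSemicontinuous f) (hb : BddBelow (Set.range f))
    (hρ_lsc : ∀ i y, LowerSemicontinuous fun x => ρ i x y) (hρ_self : ∀ i x, ρ i x x = 0)
    (hρ_nonneg : ∀ i x y, 0 ≤ ρ i x y) {c : ℕ → ℝ} (hc : Summable c)
    (hρ_le : ∀ i x y, ρ i x y ≤ c i) {η : ℕ → ℝ} (hη_pos : ∀ i, 0 < η i)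
    (hη : Tendsto η atTop (𝓝 0))
    (hρ_dist : ∀ i x y, ρ i x y ≤ η i → dist x y ≤ (1 / 2) ^ i) (x₀ : X) :
    ∃ (u : ℕ → X) (y : X), f y + ∑' i, ρ i y (u i) ≤ f x₀ ∧
      ∀ x, f y + ∑' i, ρ i y (u i) ≤ f x + ∑' i, ρ i x (u i) := by
  obtain ⟨u, hu0, hu_succ, hu_near⟩ := exists_seq_near_minimizer hb hρ_nonneg hη_pos x₀
  have hmono := monotone_partialPerturbation (f := f) hρ_nonneg u
  have hdecr (i : ℕ) :
      partialPerturbation f ρ u (i + 1) (u (i + 1)) ≤ partialPerturbation f ρ u i (u i) := by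
    simpa [partialPerturbation_succ, hρ_self] using hu_succ i
  have hdist (i : ℕ) : dist (u i) (u (i + 1)) ≤ 1 * (1 / 2) ^ i := by
    rw [one_mul, dist_comm]
    refine hρ_dist i _ _ ?_
    linarith [hdecr i, hu_near i (u (i + 1)), partialPerturbation_succ (f := f) (ρ := ρ) u i
      (u (i + 1))]
  obtain ⟨y, hy⟩ := cauchySeq_tendsto_of_complete
    (cauchySeq_of_le_geometric (1 / 2) 1 one_half_lt_one hdist)
  have hsum (x : X) : Summable fun i => ρ i x (u i) :=
    hc.of_nonneg_of_le (fun i => hρ_nonneg i x (u i)) fun i => hρ_le i x (u i)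
  have hlsc (n : ℕ) : LowerSemicontinuous (partialPerturbation f ρ u n) :=
    hf.add (lowerSemicontinuous_sum fun i _ => hρ_lsc i (u i))
  have hlimit (b : ℝ) (h : ∀ i, partialPerturbation f ρ u i (u i) ≤ b + η i) :
      f y + ∑' i, ρ i y (u i) ≤ b := by
    refine le_of_tendsto' (tendsto_partialPerturbation (hsum y)) fun n =>
      le_of_forall_pos_le_add fun ε hε => ?_
    refine ((hlsc n).isClosed_preimage (b + ε)).mem_of_tendsto hy ?_
    filter_upwards [hη.eventually_lt_const hε, eventually_ge_atTop n] with i hi hni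
    exact (hmono (u i) hni).trans ((h i).trans (by linarith))
  have hanti : Antitone fun i => partialPerturbation f ρ u i (u i) := antitone_nat_of_succ_le hdecr
  have hle_start (i : ℕ) : partialPerturbation f ρ u i (u i) ≤ f x₀ :=
    (hanti i.zero_le).trans (by simpa [partialPerturbation] using hu0)
  refine ⟨u, y, hlimit _ fun i => by linarith [hle_start i, hη_pos i],
    fun x => hlimit _ fun i => ?_⟩
  linarith [hu_near i x, (hmono x).ge_of_tendsto (tendsto_partialPerturbation (hsum x)) i]

end VariationalPrinciple

section BoundedGauge

variable {E : Type*} [NormedAddCommGroup E] [NormedSpace ℝ E]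

theorem IsSmoothGauge.exists_norm_lt_of_lt {θ : E → ℝ} (hθ : IsSmoothGauge θ) {ε : ℝ}
    (hε : 0 < ε) : ∃ δ > 0, ∀ x, θ x < δ → ‖x‖ < ε := by
  have hs_pos : 0 < min 1 (ε / 8) := lt_min one_pos (by positivity)
  refine ⟨min 1 (ε / 8) * (ε / 2), by positivity, fun x hx => ?_⟩
  have hgrowth := hθ.growth x _ hs_pos.le (min_le_left _ _)
  refine lt_of_mul_lt_mul_left ?_ hs_pos.le
  nlinarith [min_le_right 1 (ε / 8)]

/-- A bounded `C¹` substitute for the norm: `β` is small only near the origin. -/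
structure IsBoundedGauge (β : E → ℝ) : Prop where
  contDiff : ContDiff ℝ 1 β
  map_zero : β 0 = 0
  nonneg : ∀ x, 0 ≤ β x
  le_one : ∀ x, β x ≤ 1
  norm_fderiv_le_one : ∀ x, ‖fderiv ℝ β x‖ ≤ 1
  exists_norm_lt_of_lt : ∀ ε : ℝ, 0 < ε → ∃ δ > 0, ∀ x, β x < δ → ‖x‖ < ε

theorem IsSmoothGauge.isBoundedGauge {θ : E → ℝ} (hθ : IsSmoothGauge θ) :
    IsBoundedGauge fun x => 1 - (1 + θ x)⁻¹ := by
  have hone_le (x : E) : 1 ≤ 1 + θ x := le_add_of_nonneg_right (hθ.nonneg x)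
  have hpos (x : E) : 0 < 1 + θ x := one_pos.trans_le (hone_le x)
  refine ⟨contDiff_const.sub ((contDiff_const.add hθ.contDiff).inv fun x => (hpos x).ne'),
    by simp [hθ.map_zero], fun x => sub_nonneg.2 (inv_le_one_of_one_le₀ (hone_le x)),
    fun x => sub_le_self _ (inv_pos.2 (hpos x)).le, fun x => ?_, fun ε hε => ?_⟩
  · have hderiv : HasFDerivAt (fun x => 1 - (1 + θ x)⁻¹)
        (-(-((1 + θ x) ^ 2)⁻¹ • fderiv ℝ θ x)) x :=
      ((hasDerivAt_inv (hpos x).ne').comp_hasFDerivAt x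
        ((hθ.contDiff.differentiable one_ne_zero x).hasFDerivAt.const_add 1)).const_sub 1
    rw [hderiv.fderiv, norm_neg, norm_smul, norm_neg, norm_inv, Real.norm_of_nonneg (sq_nonneg _)]
    exact mul_le_one₀ (inv_le_one_of_one_le₀ (one_le_pow₀ (hone_le x))) (norm_nonneg _)
      (hθ.norm_fderiv_le_one x)
  · obtain ⟨δ, hδ, hθδ⟩ := hθ.exists_norm_lt_of_lt hε
    refine ⟨1 - (1 + δ)⁻¹, sub_pos.2 (inv_lt_one_of_one_lt₀ (lt_add_of_pos_right 1 hδ)),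
      fun x hx => hθδ x ?_⟩
    have hinv : (1 + δ)⁻¹ < (1 + θ x)⁻¹ := by linarith
    linarith [(inv_lt_inv₀ (by positivity) (hpos x)).1 hinv]

theorem contDiff_one_tsum {ι : Type*} {g : ι → E → ℝ} (hg : ∀ i, ContDiff ℝ 1 (g i)) {c : ι → ℝ}
    (hc : Summable c) (hg_le : ∀ i x, ‖g i x‖ ≤ c i) (hg' : ∀ i x, ‖fderiv ℝ (g i) x‖ ≤ c i) :
    ContDiff ℝ 1 (fun x => ∑' i, g i x) ∧ ∀ x, ‖fderiv ℝ (fun x => ∑' i, g i x) x‖ ≤ ∑' i, c i := by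
  refine ⟨contDiff_tsum (v := fun _ => c) hg (fun _ _ => hc) fun k i x hk => ?_, fun x => ?_⟩
  · obtain rfl | rfl : k = 0 ∨ k = 1 := by
      have : k ≤ 1 := by exact_mod_cast hk
      omega
    · rw [norm_iteratedFDeriv_zero]
      exact hg_le i x
    · rw [norm_iteratedFDeriv_one]
      exact hg' i x
  · rw [fderiv_tsum hc (fun i x => (hg i).differentiable one_ne_zero x) hg' (x₀ := x)
      (hc.of_norm_bounded fun i => hg_le i x)]
    exact tsum_of_norm_bounded hc.hasSum fun i => hg' i x

theorem IsBoundedGauge.exists_contDiff_forall_add_le [CompleteSpace E] {β : E → ℝ}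
    (hβ : IsBoundedGauge β) {f : E → ℝ} (hf : LowerSemicontinuous f)
    (hb : BddBelow (Set.range f)) (x₀ : E) {ε : ℝ} (hε : 0 < ε) :
    ∃ B : E → ℝ, ContDiff ℝ 1 B ∧ (∀ x, 0 ≤ B x) ∧ (∀ x, ‖fderiv ℝ B x‖ ≤ ε) ∧
      ∃ z, f z + B z ≤ f x₀ ∧ ∀ x, f z + B z ≤ f x + B x := by
  let c (i : ℕ) : ℝ := ε / 2 / 2 ^ i
  have hc_pos (i : ℕ) : 0 < c i := by positivity
  have hc : HasSum c ε := hasSum_geometric_two' ε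
  choose δ hδ_pos hδ using fun i : ℕ => hβ.exists_norm_lt_of_lt ((1 / 2) ^ i) (by positivity)
  let η (i : ℕ) : ℝ := min (c i * (δ i / 2)) ((1 / 2) ^ i)
  have hη_pos (i : ℕ) : 0 < η i :=
    lt_min (mul_pos (hc_pos i) (half_pos (hδ_pos i))) (by positivity)
  have hη : Tendsto η atTop (𝓝 0) :=
    squeeze_zero (fun i => (hη_pos i).le) (fun i => min_le_right _ _)
      (tendsto_pow_atTop_nhds_zero_of_lt_one (by norm_num) (by norm_num))
  have hgauge (u : E) : ContDiff ℝ 1 fun x => β (x - u) :=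
    hβ.contDiff.comp (contDiff_id.sub contDiff_const)
  have hnonneg (i : ℕ) (x u : E) : 0 ≤ c i * β (x - u) := mul_nonneg (hc_pos i).le (hβ.nonneg _)
  have hle (i : ℕ) (x u : E) : c i * β (x - u) ≤ c i :=
    mul_le_of_le_one_right (hc_pos i).le (hβ.le_one _)
  obtain ⟨u, z, hz₀, hz⟩ := exists_forall_add_tsum_le hf hb
    (fun i u => ((hgauge u).continuous.const_mul (c i)).lowerSemicontinuous)
    (fun i x => by rw [sub_self, hβ.map_zero, mul_zero]) hnonneg hc.summable hle hη_pos hη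
    (fun i x y h => by
      have h' := le_of_mul_le_mul_left (h.trans (min_le_left _ _)) (hc_pos i)
      exact dist_eq_norm x y ▸ (hδ i _ (h'.trans_lt (half_lt_self (hδ_pos i)))).le) x₀
  obtain ⟨hB, hB'⟩ := contDiff_one_tsum (fun i => contDiff_const.mul (hgauge (u i))) hc.summable
    (fun i x => (Real.norm_of_nonneg (hnonneg i x (u i))).trans_le (hle i x (u i)))
    (fun i x => by
      rw [fderiv_const_mul ((hgauge (u i)).differentiable one_ne_zero x), norm_smul,
        Real.norm_of_nonneg (hc_pos i).le, fderiv_comp_sub]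
      exact mul_le_of_le_one_right (hc_pos i).le (hβ.norm_fderiv_le_one _))
  exact ⟨_, hB, fun x => tsum_nonneg fun i => hnonneg i x (u i),
    fun x => (hB' x).trans_eq hc.tsum_eq, z, hz₀, hz⟩

end BoundedGauge

section ConeMinimizer

variable {E : Type*} [NormedAddCommGroup E] [NormedSpace ℝ E]

theorem mul_le_mul_abs_of_mem_Icc {t T : ℝ} (ht : t ∈ Set.Icc 0 T) (r : ℝ) : t * r ≤ T * |r| :=
  (mul_le_mul_of_nonneg_left (le_abs_self r) ht.1).trans
    (mul_le_mul_of_nonneg_right ht.2 (abs_nonneg r))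

theorem norm_smul_le_of_mem_Icc {t T R : ℝ} (ht : t ∈ Set.Icc 0 T) {w : E} (hw : ‖w‖ ≤ R) :
    ‖t • w‖ ≤ T * R := by
  rw [norm_smul, Real.norm_of_nonneg ht.1]
  exact mul_le_mul ht.2 hw (norm_nonneg _) (ht.1.trans ht.2)

theorem IsReflexiveSpace.exists_forall_sub_le_of_subgradient [CompleteSpace E]
    (hE : IsReflexiveSpace E) {g : E → ℝ}
    (hg : ∀ y, ∃ f : StrongDual ℝ E, ∀ x, f (x - y) ≤ g x - g y) {W : Set E} (hW : IsClosed W)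
    (hWconv : Convex ℝ W) (hWne : W.Nonempty) {R : ℝ} (hR : ∀ w ∈ W, ‖w‖ ≤ R) {T : ℝ}
    (hT : 0 ≤ T) (r : ℝ) :
    ∃ t ∈ Set.Icc 0 T, ∃ w ∈ W, ∀ t' ∈ Set.Icc 0 T, ∀ w' ∈ W,
      g (t • w) - t * r ≤ g (t' • w') - t' * r := by
  let values : Set ℝ := (fun p : ℝ × E => g (p.1 • p.2) - p.1 * r) '' (Set.Icc 0 T ×ˢ W)
  have hbdd : BddBelow values := by
    obtain ⟨f, hf⟩ := hg 0
    refine ⟨g 0 - ‖f‖ * (T * R) - T * |r|, Set.forall_mem_image.2 fun ⟨t, w⟩ ⟨ht, hw⟩ => ?_⟩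
    have hfw : |f (t • w)| ≤ ‖f‖ * (T * R) :=
      f.le_of_opNorm_le_of_le le_rfl (norm_smul_le_of_mem_Icc ht (hR w hw))
    have hsub := hf (t • w)
    rw [sub_zero] at hsub
    linarith [neg_le_of_abs_le hfw, mul_le_mul_abs_of_mem_Icc ht r]
  have hne : values.Nonempty :=
    Set.Nonempty.image _ ⟨(0, hWne.some), ⟨le_rfl, hT⟩, hWne.some_mem⟩
  obtain ⟨v, -, hv, hvmem⟩ := exists_seq_tendsto_sInf hne hbdd
  choose p hp hpv using hvmem
  obtain ⟨t, ht, κ, hκ, htlim⟩ := isCompact_Icc.tendsto_subseq fun k => (hp k).1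
  obtain ⟨w, κ', hκ', hwlim⟩ := hE.exists_subseq_tendsto_weakly fun k => hR _ (hp (κ k)).2
  have hw : w ∈ W := mem_of_isClosed_of_convex_of_tendsto_dual hW hWconv
    (Eventually.of_forall fun k => (hp (κ (κ' k))).2) hwlim
  let q (k : ℕ) : ℝ × E := p (κ (κ' k))
  have hqt : Tendsto (fun k => (q k).1) atTop (𝓝 t) := htlim.comp hκ'.tendsto_atTop
  refine ⟨t, ht, w, hw, fun t' ht' w' hw' =>
    le_trans ?_ (csInf_le hbdd ⟨(t', w'), ⟨ht', hw'⟩, rfl⟩)⟩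
  obtain ⟨f, hf⟩ := hg (t • w)
  have hfq : Tendsto (fun k => f ((q k).1 • (q k).2)) atTop (𝓝 (f (t • w))) := by
    simpa only [map_smul, smul_eq_mul] using hqt.mul (hwlim f)
  have hlow : Tendsto (fun k => g (t • w) + f ((q k).1 • (q k).2 - t • w) - (q k).1 * r) atTop
      (𝓝 (g (t • w) - t * r)) := by
    simpa using ((hfq.sub_const (f (t • w))).const_add (g (t • w))).sub (hqt.mul_const r)
  refine le_of_tendsto_of_tendsto' hlow (hv.comp (hκ.comp hκ').tendsto_atTop) fun k => ?_
  simp only [Function.comp_apply, ← hpv]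
  linarith [hf ((q k).1 • (q k).2)]

theorem le_apply_of_forall_sub_le {g : E → ℝ} {g' : StrongDual ℝ E} {W : Set E}
    (hW : Convex ℝ W) {t T r : ℝ} (ht : 0 ≤ t) (htT : t < T) {w : E} (hw : w ∈ W)
    (hg : HasFDerivAt g g' (t • w))
    (hmin : ∀ t' ∈ Set.Icc 0 T, ∀ w' ∈ W, g (t • w) - t * r ≤ g (t' • w') - t' * r) {v : E}
    (hv : v ∈ W) : r ≤ g' v := by
  have hline : HasDerivAt (fun s : ℝ => t • w + s • v) v 0 := by
    simpa using ((hasDerivAt_id (0 : ℝ)).smul_const v).const_add (t • w)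
  have hderiv : HasDerivAt (fun s : ℝ => g (t • w + s • v) - (t + s) * r) (g' v - r) 0 := by
    have hg0 : HasFDerivAt g g' (t • w + (0 : ℝ) • v) := by simpa using hg
    have hlin : HasDerivAt (fun s : ℝ => (t + s) * r) r 0 := by
      simpa using ((hasDerivAt_id (0 : ℝ)).const_add t).mul_const r
    exact (hg0.comp_hasDerivAt 0 hline).sub hlin
  have hminOn : IsMinOn (fun s : ℝ => g (t • w + s • v) - (t + s) * r) (Set.Icc 0 (T - t)) 0 := by
    intro s hs
    obtain ⟨u, hu, hus⟩ := hW.exists_mem_add_smul_eq hw hv ht hs.1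
    have := hmin (t + s) ⟨add_nonneg ht hs.1, by linarith [hs.2]⟩ u hu
    simpa [← hus] using this
  have hcone : T - t ∈ posTangentConeAt (Set.Icc 0 (T - t)) 0 :=
    mem_posTangentConeAt_of_segment_subset (by
      rw [zero_add, segment_eq_Icc (sub_nonneg.2 htT.le)])
  have := hminOn.localize.hasFDerivWithinAt_nonneg hderiv.hasFDerivAt.hasFDerivWithinAt hcone
  simp only [ContinuousLinearMap.toSpanSingleton_apply, smul_eq_mul] at this
  exact sub_nonneg.1 (nonneg_of_mul_nonneg_right this (sub_pos.2 htT))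

end ConeMinimizer

section MeanValue

variable {E : Type*} [NormedAddCommGroup E] [NormedSpace ℝ E] {θ : E → ℝ}

theorem IsSmoothGauge.sub_le_norm_sub (hθ : IsSmoothGauge θ) (x y : E) : θ x - θ y ≤ ‖x - y‖ := by
  have h := hθ.fderiv_apply_sub_le y x
  have hle : fderiv ℝ θ x (x - y) ≤ 1 * ‖x - y‖ :=
    (le_abs_self _).trans ((fderiv ℝ θ x).le_of_opNorm_le (hθ.norm_fderiv_le_one x) _)
  rw [← neg_sub x y, map_neg] at h
  linarith

theorem IsSmoothGauge.exists_mul_norm_sub_le (hθ : IsSmoothGauge θ) {c δ : ℝ} (hc : 0 < c)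
    (hδ : 0 < δ) : ∃ K > 0, ∀ y, c * ‖y‖ - δ ≤ K * θ y := by
  have hs_pos : 0 < min 1 (δ / (2 * c)) := lt_min one_pos (by positivity)
  refine ⟨c / min 1 (δ / (2 * c)), by positivity, fun y => ?_⟩
  have hs := (le_div_iff₀ (by positivity)).1 (min_le_right 1 (δ / (2 * c)))
  have hgrowth := hθ.growth y _ hs_pos.le (min_le_left _ _)
  generalize min 1 (δ / (2 * c)) = s at *
  calc c * ‖y‖ - δ ≤ c * ‖y‖ - s * (2 * c) := by linarith
    _ = c / s * (s * ‖y‖ - 2 * s ^ 2) := by field_simp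
    _ ≤ c / s * θ y := by gcongr

/- Minimize jointly over `z` and over the truncated cone `{t • w | t ∈ [0, T], w ∈ W}` based at
`x₀`: the partial minimum over the cone is attained by weak compactness, so that only the
dependence on `z` needs a perturbation. -/
theorem IsReflexiveSpace.exists_perturbed_minimizer [CompleteSpace E] (hE : IsReflexiveSpace E)
    (hθ : IsSmoothGauge θ) {K : ℝ} (hK : 0 ≤ K) {ψ : E → ℝ} (hψ : LowerSemicontinuous ψ) {W : Set E}
    (hW : IsClosed W) (hWconv : Convex ℝ W) (hWne : W.Nonempty) {R : ℝ} (hR : ∀ w ∈ W, ‖w‖ ≤ R)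
    (x₀ : E) {T r m : ℝ} (hT : 0 ≤ T)
    (hm : ∀ z, ∀ t ∈ Set.Icc 0 T, ∀ w ∈ W, m ≤ ψ z + (K * θ (x₀ + t • w - z) - t * r)) {ε : ℝ}
    (hε : 0 < ε) :
    ∃ B : E → ℝ, ContDiff ℝ 1 B ∧ (∀ x, ‖fderiv ℝ B x‖ ≤ ε) ∧
      ∃ z, ∃ t ∈ Set.Icc 0 T, ∃ w ∈ W,
        ψ z + (K * θ (x₀ + t • w - z) - t * r) ≤ ψ x₀ ∧
        (∀ y, ψ z + K * θ (x₀ + t • w - z) + B z ≤ ψ y + K * θ (x₀ + t • w - y) + B y) ∧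
        ∀ t' ∈ Set.Icc 0 T, ∀ w' ∈ W,
          K * θ (x₀ + t • w - z) - t * r ≤ K * θ (x₀ + t' • w' - z) - t' * r := by
  have hsubgrad (z y : E) : ∃ f : StrongDual ℝ E, ∀ x,
      f (x - y) ≤ K * θ (x₀ + x - z) - K * θ (x₀ + y - z) := by
    refine ⟨K • fderiv ℝ θ (x₀ + y - z), fun x => ?_⟩
    rw [smul_apply, smul_eq_mul, ← mul_sub, show x - y = x₀ + x - z - (x₀ + y - z) by abel]
    exact mul_le_mul_of_nonneg_left (hθ.fderiv_apply_sub_le _ _) hK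
  choose t ht w hw hmin using fun z => hE.exists_forall_sub_le_of_subgradient (hsubgrad z) hW
    hWconv hWne hR hT r
  let h (z : E) : ℝ := K * θ (x₀ + t z • w z - z) - t z * r
  have hlip : LipschitzWith K.toNNReal h := LipschitzWith.of_le_add_mul _ fun z z' => by
    have hz := hmin z (t z') (ht z') (w z') (hw z')
    have hθz := mul_le_mul_of_nonneg_left
      (hθ.sub_le_norm_sub (x₀ + t z' • w z' - z) (x₀ + t z' • w z' - z')) hK
    rw [sub_sub_sub_cancel_left] at hθz
    rw [Real.coe_toNNReal K hK, dist_comm, dist_eq_norm]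
    linarith
  obtain ⟨β, hβ⟩ : ∃ β : E → ℝ, IsBoundedGauge β := ⟨_, hθ.isBoundedGauge⟩
  obtain ⟨B, hB, hB_nonneg, hB', z, hz₀, hz⟩ := hβ.exists_contDiff_forall_add_le
    (hψ.add hlip.continuous.lowerSemicontinuous)
    ⟨m, Set.forall_mem_range.2 fun z => hm z _ (ht z) _ (hw z)⟩ x₀ hε
  refine ⟨B, hB, hB', z, t z, ht z, w z, hw z, ?_, fun y => ?_, hmin z⟩
  · have hx₀ := hmin x₀ 0 ⟨le_rfl, hT⟩ (w x₀) (hw x₀)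
    simp only [zero_smul, add_zero, sub_self, hθ.map_zero, mul_zero, zero_mul] at hx₀
    linarith [hB_nonneg z]
  · linarith [hz y, hmin y (t z) (ht z) (w z) (hw z)]

theorem IsSmoothGauge.hasFDerivAt_neg_mul_add (hθ : IsSmoothGauge θ) {B : E → ℝ}
    (hB : Differentiable ℝ B) (K : ℝ) (a z : E) :
    HasFDerivAt (fun x => -(K * θ (a - x) + B x)) (K • fderiv ℝ θ (a - z) - fderiv ℝ B z) z := by
  have hθz : HasFDerivAt (fun x => θ (a - x)) (-fderiv ℝ θ (a - z)) z := by
    simpa [Function.comp_def] using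
      ((hθ.contDiff.differentiable one_ne_zero (a - z)).hasFDerivAt).comp z
        ((hasFDerivAt_id z).const_sub a)
  refine ((hθz.const_mul K).add (hB z).hasFDerivAt).neg.congr_fderiv ?_
  module

theorem sub_sub_le_apply_add_smul_sub {ψ : E → ℝ} {L : NNReal} (hψ : LipschitzWith L ψ) (x₀ : E)
    {t T R : ℝ} (ht : t ∈ Set.Icc 0 T) {w : E} (hw : ‖w‖ ≤ R) (r : ℝ) :
    ψ x₀ - L * (T * R) - T * |r| ≤ ψ (x₀ + t • w) - t * r := by
  have hlip : ψ x₀ ≤ ψ (x₀ + t • w) + L * ‖t • w‖ := by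
    simpa using hψ.le_add_mul x₀ (x₀ + t • w)
  linarith [mul_le_mul_of_nonneg_left (norm_smul_le_of_mem_Icc ht hw) L.coe_nonneg,
    mul_le_mul_abs_of_mem_Icc ht r]

/- The multidirectional mean value inequality of Clarke and Ledyaev. The exact penalty `K * θ` is
so steep that a minimizer on the face `t = T` of the truncated cone would contradict `hgrow`. -/
theorem IsReflexiveSpace.exists_multidirectional_mean_value [CompleteSpace E]
    (hE : IsReflexiveSpace E) {ψ : E → ℝ} {L : NNReal} (hψ : LipschitzWith L ψ) {W : Set E}
    (hW : IsClosed W) (hWconv : Convex ℝ W) (hWne : W.Nonempty) {R : ℝ}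
    (hR : ∀ w ∈ W, ‖w‖ ≤ R) {x₀ : E} {r r' T : ℝ} (hT : 0 < T) (hr : r < r')
    (hgrow : ∀ w ∈ W, T * r' ≤ ψ (x₀ + T • w) - ψ x₀) {ε : ℝ} (hε : 0 < ε) :
    ∃ (g : E → ℝ) (z : E), ContDiff ℝ 1 g ∧ ‖z - x₀‖ ≤ T * (R + L * R + 1 + |r|) ∧
      (∀ y, ψ z - g z ≤ ψ y - g y) ∧ ∀ w ∈ W, r - ε * R ≤ fderiv ℝ g z w := by
  obtain ⟨θ, hθ⟩ := hE.exists_isSmoothGauge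
  obtain ⟨δ, hδ, hδ_lt⟩ := exists_between (lt_min hT (mul_pos hT (sub_pos.2 hr)))
  obtain ⟨hδT, hδr⟩ := lt_min_iff.1 hδ_lt
  obtain ⟨K, hK, hKθ⟩ := hθ.exists_mul_norm_sub_le (c := L + 1) (by positivity) hδ
  have hlow (z x : E) : ψ x + ‖x - z‖ - δ ≤ ψ z + K * θ (x - z) := by
    have hlip : ψ x ≤ ψ z + L * ‖x - z‖ := by simpa [dist_eq_norm] using hψ.le_add_mul x z
    linarith [hKθ (x - z)]
  obtain ⟨B, hB, hB', z, t, ht, w, hw, hz₀, hz, hmin⟩ := hE.exists_perturbed_minimizer (r := r)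
    hθ hK.le hψ.continuous.lowerSemicontinuous hW hWconv hWne hR x₀ hT.le
    (fun z t ht w hw => show ψ x₀ - L * (T * R) - T * |r| - δ ≤ _ by
      linarith [hlow z (x₀ + t • w), sub_sub_le_apply_add_smul_sub hψ x₀ ht (hR w hw) r,
        norm_nonneg (x₀ + t • w - z)]) hε
  have hnear : ψ (x₀ + t • w) + ‖x₀ + t • w - z‖ - δ - t * r ≤ ψ x₀ := by
    linarith [hlow z (x₀ + t • w)]
  have htT : t < T := ht.2.lt_of_ne fun h => by
    have hgrow_w := hgrow w hw
    rw [h] at hnear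
    linarith [norm_nonneg (x₀ + T • w - z)]
  refine ⟨fun x => -(K * θ (x₀ + t • w - x) + B x), z,
    ((contDiff_const.mul (hθ.contDiff.comp (contDiff_const.sub contDiff_id))).add hB).neg, ?_,
    fun y => by linarith [hz y], fun v hv => ?_⟩
  · calc ‖z - x₀‖ = ‖t • w - (x₀ + t • w - z)‖ := by congr 1; abel
      _ ≤ ‖t • w‖ + ‖x₀ + t • w - z‖ := norm_sub_le _ _
      _ ≤ T * (R + L * R + 1 + |r|) := by
        linarith [norm_smul_le_of_mem_Icc ht (hR w hw),
          sub_sub_le_apply_add_smul_sub hψ x₀ ht (hR w hw) r]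
  · have hslope : r ≤ (K • fderiv ℝ θ (x₀ + t • w - z)) v :=
      le_apply_of_forall_sub_le (g := fun x => K * θ (x₀ + x - z)) hWconv ht.1 htT hw
        ((((hθ.contDiff.differentiable one_ne_zero _).hasFDerivAt).comp (t • w)
          (((hasFDerivAt_id (t • w)).const_add x₀).sub_const z)).const_mul K) hmin hv
    have hBv : fderiv ℝ B z v ≤ ε * R :=
      (le_abs_self _).trans ((fderiv ℝ B z).le_of_opNorm_le_of_le (hB' z) (hR v hv))
    rw [(hθ.hasFDerivAt_neg_mul_add (hB.differentiable one_ne_zero) K _ z).fderiv, sub_apply]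
    linarith

end MeanValue

/-! ### Dini derivatives and subdifferentials in charts -/

section Charts

variable {E : Type*} [NormedAddCommGroup E] [NormedSpace ℝ E]
  {M : Type*} [TopologicalSpace M] [ChartedSpace E M]
  {φ φ' : OpenPartialHomeomorph M E} {p : M}

theorem IsChartAround.contMDiffAt (h : IsChartAround φ p) :
    ContMDiffAt 𝓘(ℝ, E) 𝓘(ℝ, E) 1 φ p :=
  contMDiffAt_of_mem_maximalAtlas h.1 h.2

theorem IsChartAround.mdifferentiableAt (h : IsChartAround φ p) :
    MDifferentiableAt 𝓘(ℝ, E) 𝓘(ℝ, E) φ p :=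
  h.contMDiffAt.mdifferentiableAt one_ne_zero

theorem IsChartAround.of_mem_source {p' : M} (h : IsChartAround φ p) (hp' : p' ∈ φ.source) :
    IsChartAround φ p' :=
  ⟨h.1, hp'⟩

theorem IsChartAround.source_mem_nhds (h : IsChartAround φ p) : φ.source ∈ 𝓝 p :=
  φ.open_source.mem_nhds h.2

theorem IsChartAround.target_mem_nhds (h : IsChartAround φ p) : φ.target ∈ 𝓝 (φ p) :=
  φ.open_target.mem_nhds (φ.map_source h.2)

theorem IsChartAround.symm_preimage_mem_nhds (h : IsChartAround φ p) {s : Set M} (hs : s ∈ 𝓝 p) :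
    φ.symm ⁻¹' s ∈ 𝓝 (φ p) :=
  (φ.continuousAt_symm (φ.map_source h.2)).preimage_mem_nhds (by rwa [φ.left_inv h.2])

theorem IsChartAround.isInvertible_mvfderiv (h : IsChartAround φ p) :
    (mvfderiv 𝓘(ℝ, E) φ p).IsInvertible := by
  have hd : φ.MDifferentiable 𝓘(ℝ, E) 𝓘(ℝ, E) :=
    ⟨(contMDiffOn_of_mem_maximalAtlas h.1).mdifferentiableOn one_ne_zero,
      (contMDiffOn_symm_of_mem_maximalAtlas h.1).mdifferentiableOn one_ne_zero⟩
  exact ⟨(hd.mfderiv h.2).trans (NormedSpace.fromTangentSpace (φ p)), rfl⟩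

theorem IsChartAround.mvfderiv_eq_comp {F : Type*} [NormedAddCommGroup F] [NormedSpace ℝ F]
    {g : M → F} {h : E → F} (hφ : IsChartAround φ p) (hh : DifferentiableAt ℝ h (φ p))
    (hg : g =ᶠ[𝓝 p] h ∘ φ) :
    mvfderiv 𝓘(ℝ, E) g p = (fderiv ℝ h (φ p)).comp (mvfderiv 𝓘(ℝ, E) φ p) := by
  have hcomp : HasMFDerivAt 𝓘(ℝ, E) 𝓘(ℝ, F) (h ∘ φ) p
      ((fderiv ℝ h (φ p)).comp (mfderiv 𝓘(ℝ, E) 𝓘(ℝ, E) φ p)) :=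
    hh.hasFDerivAt.hasMFDerivAt.comp p hφ.mdifferentiableAt.hasMFDerivAt
  ext v
  exact congrArg (fun A => A v) (hcomp.congr_of_eventuallyEq hg).mfderiv

theorem IsChartAround.contDiffAt_transition (hφ : IsChartAround φ p) (hφ' : IsChartAround φ' p) :
    ContDiffAt ℝ 1 (φ ∘ φ'.symm) (φ' p) := by
  rw [← contMDiffAt_iff_contDiffAt]
  refine ContMDiffAt.comp (φ' p) ?_
    (contMDiffAt_symm_of_mem_maximalAtlas hφ'.1 (φ'.map_source hφ'.2))
  rw [φ'.left_inv hφ'.2]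
  exact hφ.contMDiffAt

theorem IsChartAround.mvfderiv_inverse_apply (hφ : IsChartAround φ p) (hφ' : IsChartAround φ' p)
    (w : E) :
    mvfderiv 𝓘(ℝ, E) φ p ((mvfderiv 𝓘(ℝ, E) φ' p).inverse w) =
      fderiv ℝ (φ ∘ φ'.symm) (φ' p) w := by
  have hchain : mvfderiv 𝓘(ℝ, E) φ p =
      (fderiv ℝ (φ ∘ φ'.symm) (φ' p)).comp (mvfderiv 𝓘(ℝ, E) φ' p) := by
    refine hφ'.mvfderiv_eq_comp
      ((hφ.contDiffAt_transition hφ').differentiableAt one_ne_zero) ?_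
    filter_upwards [hφ'.source_mem_nhds] with p' hp'
    simp [φ'.left_inv hp']
  obtain ⟨A, hA⟩ := hφ'.isInvertible_mvfderiv
  rw [hchain, ← hA]
  simp

theorem IsLocallyLipschitzOnManifold.exists_lipschitzOnWith_comp_symm {ℓ : M → ℝ}
    (hℓ : IsLocallyLipschitzOnManifold (E := E) ℓ) (hφ : IsChartAround φ p) :
    ∃ K : NNReal, ∃ U ∈ 𝓝 (φ p), LipschitzOnWith K (ℓ ∘ φ.symm) U := by
  obtain ⟨φ', hφ', K', U', hU', hLip'⟩ := hℓ p
  have htrans := hφ'.contDiffAt_transition hφ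
  obtain ⟨K, t, ht, hLip⟩ := htrans.exists_lipschitzOnWith
  have hpre : (φ' ∘ φ.symm) ⁻¹' U' ∈ 𝓝 (φ p) :=
    htrans.continuousAt.preimage_mem_nhds (by simpa [φ.left_inv hφ.2] using hU')
  have hsource : φ.symm ⁻¹' φ'.source ∈ 𝓝 (φ p) := hφ.symm_preimage_mem_nhds hφ'.source_mem_nhds
  refine ⟨K' * K, t ∩ ((φ' ∘ φ.symm) ⁻¹' U' ∩ φ.symm ⁻¹' φ'.source),
    inter_mem ht (inter_mem hpre hsource), ?_⟩
  have heq : Set.EqOn (ℓ ∘ φ.symm) ((ℓ ∘ φ'.symm) ∘ φ' ∘ φ.symm)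
      (t ∩ ((φ' ∘ φ.symm) ⁻¹' U' ∩ φ.symm ⁻¹' φ'.source)) := fun y hy => by
    simp [φ'.left_inv hy.2.2]
  intro x hx y hy
  rw [heq hx, heq hy]
  exact hLip'.comp (hLip.mono Set.inter_subset_left) (fun z hz => hz.2.1) hx hy

theorem IsBoundedGauge.exists_contDiff_bump {β : E → ℝ} (hβ : IsBoundedGauge β) (x₀ : E) {ε : ℝ}
    (hε : 0 < ε) :
    ∃ χ : E → ℝ, ContDiff ℝ 1 χ ∧ (∀ᶠ y in 𝓝 x₀, χ y = 1) ∧ ∀ y, χ y ≠ 0 → ‖y - x₀‖ < ε := by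
  obtain ⟨δ, hδ, hδε⟩ := hβ.exists_norm_lt_of_lt ε hε
  have hβcont : Continuous β := hβ.contDiff.continuous
  refine ⟨fun y => Real.smoothTransition (2 - 3 * (β (y - x₀) / δ)), ?_, ?_, fun y hy => ?_⟩
  · refine (Real.smoothTransition.contDiff (n := 1)).comp
      (contDiff_const.sub (contDiff_const.mul ?_))
    exact (hβ.contDiff.comp (contDiff_id.sub contDiff_const)).div_const δ
  · have hcont : ContinuousAt (fun y => β (y - x₀) / δ) x₀ := by fun_prop
    have hlt : β (x₀ - x₀) / δ < 1 / 3 := by simp [hβ.map_zero]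
    filter_upwards [hcont.eventually (gt_mem_nhds hlt)] with y hy
    exact Real.smoothTransition.one_of_one_le (by linarith)
  · refine hδε _ (not_le.1 fun hle => hy (Real.smoothTransition.zero_of_nonpos ?_))
    have : 1 ≤ β (y - x₀) / δ := (one_le_div hδ).2 hle
    linarith

/- Regularity of `M` provides a closed neighbourhood of `p` inside the chart domain. A bump
supported in it makes the extension by zero smooth at the points outside the chart domain too. -/
theorem IsChartAround.exists_contMDiff_eventuallyEq_comp [RegularSpace M] {β : E → ℝ}
    (hβ : IsBoundedGauge β) (hφ : IsChartAround φ p) {h : E → ℝ} (hh : ContDiff ℝ 1 h) :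
    ∃ g : M → ℝ, ContMDiff 𝓘(ℝ, E) 𝓘(ℝ, ℝ) 1 g ∧ g =ᶠ[𝓝 p] h ∘ φ := by
  classical
  obtain ⟨N, hN, hNclosed, hNsource⟩ := exists_mem_nhds_isClosed_subset hφ.source_mem_nhds
  obtain ⟨ε, hε, hball⟩ := Metric.mem_nhds_iff.1 (hφ.symm_preimage_mem_nhds hN)
  obtain ⟨χ, hχ, hχ_one, hχ_supp⟩ := hβ.exists_contDiff_bump (φ p) hε
  set g : M → ℝ := fun x => if x ∈ φ.source then χ (φ x) * h (φ x) else 0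
  have g_eq : ∀ x ∈ φ.source, g x = χ (φ x) * h (φ x) := fun x hx => if_pos hx
  have g_eq_zero : ∀ x ∉ N, g x = 0 := fun x hxN => by
    by_cases hx : x ∈ φ.source
    · by_contra hne
      rw [g_eq x hx] at hne
      have hxball : φ x ∈ Metric.ball (φ p) ε :=
        mem_ball_iff_norm.2 (hχ_supp _ (left_ne_zero_of_mul hne))
      exact hxN (by simpa [φ.left_inv hx] using hball hxball)
    · exact if_neg hx
  refine ⟨g, fun x => ?_, ?_⟩
  · by_cases hx : x ∈ φ.source
    · refine ((hχ.mul hh).contMDiff.contMDiffAt.comp x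
        (hφ.of_mem_source hx).contMDiffAt).congr_of_eventuallyEq ?_
      filter_upwards [φ.open_source.mem_nhds hx] with y hy using g_eq y hy
    · refine (contMDiffAt_const (c := (0 : ℝ))).congr_of_eventuallyEq ?_
      filter_upwards [hNclosed.isOpen_compl.mem_nhds fun hxN => hx (hNsource hxN)] with y hy
        using g_eq_zero y hy
  · filter_upwards [hφ.source_mem_nhds, (φ.continuousAt hφ.2).eventually hχ_one] with x hx hx_one
    simp only [g_eq x hx, hx_one, one_mul, Function.comp_apply]

theorem IsChartAround.comp_mvfderiv_mem_frechetSubdifferential [RegularSpace M] {β : E → ℝ}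
    (hβ : IsBoundedGauge β) {ψ : M → ℝ} (hφ : IsChartAround φ p) {h : E → ℝ}
    (hh : ContDiff ℝ 1 h) (hmin : IsLocalMin (fun y => ψ (φ.symm y) - h y) (φ p)) :
    (fderiv ℝ h (φ p)).comp (mvfderiv 𝓘(ℝ, E) φ p) ∈ frechetSubdifferential ψ p := by
  obtain ⟨g, hg, hgh⟩ := hφ.exists_contMDiff_eventuallyEq_comp hβ hh
  refine ⟨g, hg, ?_, hφ.mvfderiv_eq_comp (hh.differentiable one_ne_zero _) hgh⟩
  filter_upwards [hgh, hφ.source_mem_nhds, (φ.continuousAt hφ.2).eventually hmin]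
    with x hx hxs hxmin
  simpa only [φ.left_inv hφ.2, φ.left_inv hxs, hx, hgh.eq_of_nhds, Function.comp_apply] using hxmin

end Charts

section UniformGrowth

variable {E : Type*} [NormedAddCommGroup E] [NormedSpace ℝ E]
  {ψ ψ' : E → ℝ} {x₀ : E} {W : Set E} {r : ℝ}

/-- Growth of `ψ` at `x₀` at every rate `r₁ < r` along all directions in `W`, for times `T` that
are small uniformly in the direction. This is what a lower bound on the weak lower Dini derivatives
amounts to in a chart, and what the mean value inequality consumes. -/
def HasUniformGrowth (ψ : E → ℝ) (x₀ : E) (W : Set E) (r : ℝ) : Prop :=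
  ∀ r₁ < r, ∀ᶠ T in 𝓝[>] (0 : ℝ), ∀ w ∈ W, T * r₁ ≤ ψ (x₀ + T • w) - ψ x₀

theorem HasUniformGrowth.congr (h : HasUniformGrowth ψ x₀ W r) (hW : Bornology.IsBounded W)
    (heq : ψ =ᶠ[𝓝 x₀] ψ') : HasUniformGrowth ψ' x₀ W r := by
  intro r₁ hr₁
  have hpre : {y | ψ (x₀ + y) = ψ' (x₀ + y)} ∈ 𝓝 (0 : E) :=
    (show Tendsto (x₀ + ·) (𝓝 0) (𝓝 x₀) by
      simpa using (continuous_const_add x₀).tendsto (0 : E)).eventually heq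
  have habs : ∀ᶠ T in 𝓝 (0 : ℝ), ∀ w ∈ W, ψ (x₀ + T • w) = ψ' (x₀ + T • w) :=
    (NormedSpace.isVonNBounded_of_isBounded ℝ hW hpre).eventually_nhds_zero (mem_of_mem_nhds hpre)
  filter_upwards [h r₁ hr₁, nhdsWithin_le_nhds habs] with T hT hTeq w hw
  rw [← hTeq w hw, ← heq.eq_of_nhds]
  exact hT w hw

theorem hasUniformGrowth_singleton_zero (ψ : E → ℝ) (x₀ : E) : HasUniformGrowth ψ x₀ {0} 0 := by
  intro r₁ hr₁
  filter_upwards [self_mem_nhdsWithin] with T hT w hw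
  rw [Set.mem_singleton_iff.1 hw, smul_zero, add_zero, sub_self]
  exact mul_nonpos_of_nonneg_of_nonpos (le_of_lt hT) hr₁.le

theorem norm_fderiv_le_of_isLocalMin_sub {h : E → ℝ} {L : NNReal} (hψ : LipschitzWith L ψ) {z : E}
    (hh : DifferentiableAt ℝ h z) (hmin : IsLocalMin (fun y => ψ y - h y) z) :
    ‖fderiv ℝ h z‖ ≤ L := by
  have apply_le (v : E) : fderiv ℝ h z v ≤ L * ‖v‖ := by
    have htend : Tendsto (fun c : ℝ => z + c⁻¹ • v) atTop (𝓝 z) := by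
      simpa using ((tendsto_inv_atTop_zero (𝕜 := ℝ)).smul_const v).const_add z
    refine le_of_tendsto (hh.hasFDerivAt.lim_real v) ?_
    filter_upwards [htend.eventually hmin, eventually_gt_atTop 0] with c hc hc0
    have hle : h (z + c⁻¹ • v) - h z ≤ ψ (z + c⁻¹ • v) - ψ z := by linarith
    calc c * (h (z + c⁻¹ • v) - h z) ≤ c * (ψ (z + c⁻¹ • v) - ψ z) := by gcongr
      _ ≤ c * (L * ‖z + c⁻¹ • v - z‖) := by
        gcongr
        exact (le_abs_self _).trans (hψ.norm_sub_le _ _)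
      _ = L * ‖v‖ := by
        rw [add_sub_cancel_left, norm_smul, norm_inv, Real.norm_of_nonneg hc0.le]
        field_simp
  refine ContinuousLinearMap.opNorm_le_bound _ L.2 fun v => abs_le.2 ⟨?_, apply_le v⟩
  have := apply_le (-v)
  rw [map_neg, norm_neg] at this
  linarith

variable [CompleteSpace E] {L : NNReal}

theorem HasUniformGrowth.exists_approx_subgradient (hgrow : HasUniformGrowth ψ x₀ W r)
    (hE : IsReflexiveSpace E) (hψ : LipschitzWith L ψ) (hW : IsClosed W) (hWconv : Convex ℝ W)
    (hWne : W.Nonempty) (hWb : Bornology.IsBounded W) {U : Set E} (hU : U ∈ 𝓝 x₀) {ε : ℝ}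
    (hε : 0 < ε) :
    ∃ (h : E → ℝ) (z : E), ContDiff ℝ 1 h ∧ z ∈ U ∧ IsLocalMin (fun y => ψ y - h y) z ∧
      ∀ w ∈ W, r - ε ≤ fderiv ℝ h z w := by
  obtain ⟨η, hη, hηU⟩ := Metric.mem_nhds_iff.1 hU
  obtain ⟨R, hR_pos, hR⟩ := hWb.exists_pos_norm_le
  have hD : 0 < R + L * R + 1 + |r - ε / 2| := by positivity
  have hsmall : ∀ᶠ T in 𝓝[>] (0 : ℝ), T < η / (R + L * R + 1 + |r - ε / 2|) :=
    nhdsWithin_le_nhds (gt_mem_nhds (div_pos hη hD))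
  obtain ⟨T, hT_grow, hT_lt, hT⟩ :=
    ((hgrow (r - ε / 4) (by linarith)).and (hsmall.and self_mem_nhdsWithin)).exists
  obtain ⟨h, z, hh, hz, hmin, hle⟩ := hE.exists_multidirectional_mean_value hψ hW hWconv hWne hR hT
    (show r - ε / 2 < r - ε / 4 by linarith) hT_grow (show 0 < ε / 2 / R by positivity)
  refine ⟨h, z, hh, hηU (mem_ball_iff_norm.2 (hz.trans_lt ((lt_div_iff₀ hD).1 hT_lt))),
    Eventually.of_forall hmin, fun w hw => ?_⟩
  have := hle w hw
  rw [div_mul_cancel₀ _ hR_pos.ne'] at this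
  linarith

theorem HasUniformGrowth.exists_seq_subgradient (hgrow : HasUniformGrowth ψ x₀ W r)
    (hE : IsReflexiveSpace E) (hψ : LipschitzWith L ψ) (hW : IsClosed W) (hWconv : Convex ℝ W)
    (hWne : W.Nonempty) (hWb : Bornology.IsBounded W) {U : Set E} (hU : U ∈ 𝓝 x₀) :
    ∃ (h : ℕ → E → ℝ) (z : ℕ → E) (ζ : StrongDual ℝ E),
      (∀ k, ContDiff ℝ 1 (h k)) ∧ (∀ k, z k ∈ U) ∧ Tendsto z atTop (𝓝 x₀) ∧
      (∀ k, IsLocalMin (fun y => ψ y - h k y) (z k)) ∧ (∀ k, ‖fderiv ℝ (h k) (z k)‖ ≤ L) ∧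
      (∀ v, Tendsto (fun k => fderiv ℝ (h k) (z k) v) atTop (𝓝 (ζ v))) ∧ ∀ w ∈ W, r ≤ ζ w := by
  obtain ⟨B, hB⟩ := (𝓝 x₀).exists_antitone_basis
  choose h z hh hz hmin hle using fun k : ℕ => hgrow.exists_approx_subgradient hE hψ hW hWconv hWne
    hWb (inter_mem hU (hB.mem k)) (Nat.one_div_pos_of_nat (n := k) (α := ℝ))
  have hnorm (k : ℕ) : ‖fderiv ℝ (h k) (z k)‖ ≤ L :=
    norm_fderiv_le_of_isLocalMin_sub hψ ((hh k).differentiable one_ne_zero _) (hmin k)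
  obtain ⟨ζ, κ, hκ, hζ⟩ := hE.exists_subseq_tendsto_dual hnorm
  refine ⟨fun k => h (κ k), fun k => z (κ k), ζ, fun k => hh _, fun k => (hz _).1,
    (hB.tendsto fun k => (hz k).2).comp hκ.tendsto_atTop, fun k => hmin _, fun k => hnorm _, hζ,
    fun w hw => ?_⟩
  have hlim : Tendsto (fun k => r - 1 / ((κ k : ℝ) + 1)) atTop (𝓝 r) := by
    simpa using (tendsto_one_div_add_atTop_nhds_zero_nat.comp hκ.tendsto_atTop).const_sub r
  exact le_of_tendsto_of_tendsto' hlim (hζ w) fun k => hle (κ k) w hw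

end UniformGrowth

section Manifold

variable {E : Type*} [NormedAddCommGroup E] [NormedSpace ℝ E]

theorem tendsto_apply_of_norm_le {u : ℕ → StrongDual ℝ E} {ζ : StrongDual ℝ E} {C : ℝ}
    (hu : ∀ k, ‖u k‖ ≤ C) (hζ : ∀ w, Tendsto (fun k => u k w) atTop (𝓝 (ζ w))) {w : ℕ → E} {w₀ : E}
    (hw : Tendsto w atTop (𝓝 w₀)) : Tendsto (fun k => u k (w k)) atTop (𝓝 (ζ w₀)) := by
  have hdiff : Tendsto (fun k => u k (w k - w₀)) atTop (𝓝 0) := by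
    refine squeeze_zero_norm (fun k => (u k).le_of_opNorm_le (hu k) _) ?_
    simpa using (tendsto_iff_norm_sub_tendsto_zero.1 hw).const_mul C
  simpa using hdiff.add (hζ w₀)

variable {M : Type*} [TopologicalSpace M] [ChartedSpace E M] {φ : OpenPartialHomeomorph M E}
  {ℓ : M → ℝ} {q : M}

/- In another chart the coordinate expressions differ by the derivatives of the transition map at
the points `p k`, which converge in norm. -/
theorem CovectorsTendstoWeakly.of_chart (hφ : IsChartAround φ q) {p : ℕ → M}
    (hp : Tendsto p atTop (𝓝 q)) {u : ℕ → StrongDual ℝ E} {ζ : StrongDual ℝ E} {C : ℝ}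
    (hu : ∀ k, ‖u k‖ ≤ C) (hζ : ∀ w, Tendsto (fun k => u k w) atTop (𝓝 (ζ w))) :
    CovectorsTendstoWeakly p (fun k => (u k).comp (mvfderiv 𝓘(ℝ, E) φ (p k))) q
      (ζ.comp (mvfderiv 𝓘(ℝ, E) φ q)) := by
  intro φ' hφ' w
  have htrans : Tendsto (fun k => fderiv ℝ (φ ∘ φ'.symm) (φ' (p k)) w) atTop
      (𝓝 (fderiv ℝ (φ ∘ φ'.symm) (φ' q) w)) :=
    (((hφ.contDiffAt_transition hφ').continuousAt_fderiv one_ne_zero).clm_apply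
      continuousAt_const).tendsto.comp ((φ'.continuousAt hφ'.2).tendsto.comp hp)
  rw [ContinuousLinearMap.comp_apply, hφ.mvfderiv_inverse_apply hφ']
  refine (tendsto_apply_of_norm_le hu hζ htrans).congr' ?_
  filter_upwards [hp hφ.source_mem_nhds, hp hφ'.source_mem_nhds] with k hk hk'
  rw [ContinuousLinearMap.comp_apply,
    (hφ.of_mem_source hk).mvfderiv_inverse_apply (hφ'.of_mem_source hk')]

variable [CompleteSpace E]

theorem HasUniformGrowth.exists_mem_limitingSubdifferential [RegularSpace M] {W : Set E} {r : ℝ}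
    (hgrow : HasUniformGrowth (ℓ ∘ φ.symm) (φ q) W r) (hE : IsReflexiveSpace E)
    (hℓ : IsLocallyLipschitzOnManifold (E := E) ℓ) (hφ : IsChartAround φ q) (hW : IsClosed W)
    (hWconv : Convex ℝ W) (hWne : W.Nonempty) (hWb : Bornology.IsBounded W) :
    ∃ ζ ∈ limitingSubdifferential ℓ q, ∀ v, mvfderiv 𝓘(ℝ, E) φ q v ∈ W → r ≤ ζ v := by
  obtain ⟨θ, hθ⟩ := hE.exists_isSmoothGauge
  obtain ⟨L, U, hU, hLip⟩ := hℓ.exists_lipschitzOnWith_comp_symm hφ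
  obtain ⟨ψ, hψ, hℓψ⟩ := hLip.extend_real
  obtain ⟨h, z, ζ, hh, hz, hzlim, hmin, hnorm, hζ, hle⟩ :=
    (hgrow.congr hWb (hℓψ.eventuallyEq_of_mem hU)).exists_seq_subgradient hE hψ hW hWconv hWne hWb
      (inter_mem (interior_mem_nhds.2 hU) hφ.target_mem_nhds)
  have hφz (k : ℕ) : φ (φ.symm (z k)) = z k := φ.right_inv (hz k).2
  have hchart (k : ℕ) : IsChartAround φ (φ.symm (z k)) := hφ.of_mem_source (φ.map_target (hz k).2)
  have hp : Tendsto (fun k => φ.symm (z k)) atTop (𝓝 q) := by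
    have := (φ.continuousAt_symm (φ.map_source hφ.2)).tendsto.comp hzlim
    rwa [φ.left_inv hφ.2] at this
  have hval : Tendsto (fun k => ℓ (φ.symm (z k))) atTop (𝓝 (ℓ q)) := by
    have := (hLip.continuousOn.continuousAt hU).tendsto.comp hzlim
    rwa [Function.comp_apply, φ.left_inv hφ.2] at this
  have hsub (k : ℕ) : (fderiv ℝ (h k) (z k)).comp (mvfderiv 𝓘(ℝ, E) φ (φ.symm (z k))) ∈
      frechetSubdifferential ℓ (φ.symm (z k)) := by
    have hloc : IsLocalMin (fun y => ℓ (φ.symm y) - h k y) (z k) := by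
      refine (hmin k).congr ?_
      filter_upwards [mem_interior_iff_mem_nhds.1 (hz k).1] with y hy
      rw [← hℓψ hy, Function.comp_apply]
    have := (hchart k).comp_mvfderiv_mem_frechetSubdifferential hθ.isBoundedGauge (hh k)
      (by rwa [hφz])
    rwa [hφz] at this
  exact ⟨ζ.comp (mvfderiv 𝓘(ℝ, E) φ q), ⟨_, _, hp, hval, hsub,
    CovectorsTendstoWeakly.of_chart hφ hp hnorm hζ⟩, fun v hv => hle _ hv⟩

end Manifold

section WeakLowerDini

variable {E : Type*} [NormedAddCommGroup E] [NormedSpace ℝ E]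

theorem isBounded_image_of_isVonNBounded {F : Type*} [AddCommGroup F] [Module ℝ F]
    [TopologicalSpace F] (A : F →L[ℝ] E) {s : Set F} (hs : Bornology.IsVonNBounded ℝ s) :
    Bornology.IsBounded (A '' s) :=
  (NormedSpace.isVonNBounded_iff ℝ).1 (hs.image A)

variable {M : Type*} [TopologicalSpace M] [ChartedSpace E M] {φ : OpenPartialHomeomorph M E}
  {ℓ : M → ℝ} {q : M} {V : Set (TangentSpace 𝓘(ℝ, E) q)}

theorem IsChartAround.isClosed_image_mvfderiv (hφ : IsChartAround φ q) (hV : IsClosed V) :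
    IsClosed (mvfderiv 𝓘(ℝ, E) φ q '' V) := by
  obtain ⟨A, hA⟩ := hφ.isInvertible_mvfderiv
  rw [← hA]
  exact A.toHomeomorph.isClosedMap _ hV

theorem IsReflexiveSpace.exists_subseq_tendsto_weakly_tangent [CompleteSpace E]
    (hE : IsReflexiveSpace E) (hφ : IsChartAround φ q) (hVclosed : IsClosed V)
    (hVbdd : Bornology.IsVonNBounded ℝ V) (hVconv : Convex ℝ V)
    {v : ℕ → TangentSpace 𝓘(ℝ, E) q} (hv : ∀ n, v n ∈ V) :
    ∃ v₀ ∈ V, ∃ κ : ℕ → ℕ, StrictMono κ ∧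
      ∀ ξ : TangentSpace 𝓘(ℝ, E) q →L[ℝ] ℝ, Tendsto (fun n => ξ (v (κ n))) atTop (𝓝 (ξ v₀)) := by
  obtain ⟨R, hR⟩ := (isBounded_image_of_isVonNBounded (mvfderiv 𝓘(ℝ, E) φ q) hVbdd).exists_norm_le
  obtain ⟨w, κ, hκ, hw⟩ := hE.exists_subseq_tendsto_weakly
    (v := fun n => mvfderiv 𝓘(ℝ, E) φ q (v n)) fun n => hR _ (Set.mem_image_of_mem _ (hv n))
  obtain ⟨v₀, hv₀, rfl⟩ := mem_of_isClosed_of_convex_of_tendsto_dual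
    (hφ.isClosed_image_mvfderiv hVclosed) (hVconv.linear_image (mvfderiv 𝓘(ℝ, E) φ q).toLinearMap)
    (Eventually.of_forall fun n => Set.mem_image_of_mem _ (hv (κ n))) hw
  obtain ⟨A, hA⟩ := hφ.isInvertible_mvfderiv
  refine ⟨v₀, hv₀, κ, hκ, fun ξ => ?_⟩
  simpa [← hA] using hw (ξ.comp (A.symm : E →L[ℝ] _))

theorem IsReflexiveSpace.hasUniformGrowth_of_le_weakLowerDini [CompleteSpace E]
    (hE : IsReflexiveSpace E) (hφ : IsChartAround φ q) (hVclosed : IsClosed V)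
    (hVbdd : Bornology.IsVonNBounded ℝ V) (hVconv : Convex ℝ V) {r : ℝ}
    (hr : ∀ v ∈ V, (r : EReal) ≤ weakLowerDini φ ℓ q V v) :
    HasUniformGrowth (ℓ ∘ φ.symm) (φ q) (mvfderiv 𝓘(ℝ, E) φ q '' V) r := by
  intro r₁ hr₁
  by_contra hcon
  obtain ⟨t, ht, hbad⟩ := exists_seq_forall_of_frequently
    ((not_eventually.1 hcon).and_eventually self_mem_nhdsWithin)
  have ht_pos (n : ℕ) : 0 < t n := (hbad n).2
  simp only [Set.forall_mem_image, not_forall, not_le, exists_prop, Function.comp_apply,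
    φ.left_inv hφ.2] at hbad
  choose v hv hlt using fun n => (hbad n).1
  obtain ⟨v₀, hv₀, κ, hκ, hweak⟩ :=
    hE.exists_subseq_tendsto_weakly_tangent hφ hVclosed hVbdd hVconv hv
  obtain ⟨Q, κ', hκ', hQ⟩ := CompactSpace.tendsto_subseq fun n =>
    (((ℓ (φ.symm (φ q + t (κ n) • mvfderiv 𝓘(ℝ, E) φ q (v (κ n)))) - ℓ q) / t (κ n) : ℝ) : EReal)
  have hDini_le : weakLowerDini φ ℓ q V v₀ ≤ Q :=
    sInf_le ⟨fun n => v (κ (κ' n)), fun n => t (κ (κ' n)), fun n => hv _,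
      fun ξ => (hweak ξ).comp hκ'.tendsto_atTop, fun n => ht_pos _,
      (tendsto_nhds_of_tendsto_nhdsWithin ht).comp (hκ.comp hκ').tendsto_atTop, hQ⟩
  have hQ_le : Q ≤ (r₁ : EReal) := le_of_tendsto' hQ fun n => by
    rw [Function.comp_apply, EReal.coe_le_coe_iff, div_le_iff₀ (ht_pos _), mul_comm]
    exact (hlt _).le
  exact ((hr v₀ hv₀).trans (hDini_le.trans hQ_le)).not_gt (EReal.coe_lt_coe_iff.2 hr₁)

end WeakLowerDini

theorem mainTheorem3 {E : Type*} [NormedAddCommGroup E] [NormedSpace ℝ E] [CompleteSpace E]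
    (hE : IsReflexiveSpace E)
    {M : Type*} [TopologicalSpace M] [T3Space M] [ChartedSpace E M] [IsManifold 𝓘(ℝ, E) 1 M]
    (ℓ : M → ℝ) (hℓ : IsLocallyLipschitzOnManifold (E := E) ℓ) (q : M)
    (V : Set (TangentSpace 𝓘(ℝ, E) q))
    (hVclosed : IsClosed V) (hVbdd : Bornology.IsVonNBounded ℝ V) (hVconv : Convex ℝ V)
    (φ : OpenPartialHomeomorph M E) (hφ : IsChartAround φ q) (r : ℝ)
    (hr : ∀ v ∈ V, (r : EReal) ≤ weakLowerDini φ ℓ q V v) :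
    ∃ ζ ∈ limitingSubdifferential ℓ q, ∀ v ∈ V, r ≤ ζ v := by
  rcases V.eq_empty_or_nonempty with rfl | hVne
  · obtain ⟨ζ, hζ, -⟩ := (hasUniformGrowth_singleton_zero (ℓ ∘ φ.symm)
      (φ q)).exists_mem_limitingSubdifferential hE hℓ hφ isClosed_singleton (convex_singleton 0)
      (Set.singleton_nonempty 0) Bornology.isBounded_singleton
    exact ⟨ζ, hζ, fun v hv => absurd hv (Set.notMem_empty v)⟩
  · have hgrow := hE.hasUniformGrowth_of_le_weakLowerDini hφ hVclosed hVbdd hVconv hr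
    obtain ⟨ζ, hζ, hle⟩ := hgrow.exists_mem_limitingSubdifferential hE hℓ hφ
      (hφ.isClosed_image_mvfderiv hVclosed)
      (hVconv.linear_image (mvfderiv 𝓘(ℝ, E) φ q).toLinearMap) (hVne.image _)
      (isBounded_image_of_isVonNBounded _ hVbdd)
    exact ⟨ζ, hζ, fun v hv => hle v (Set.mem_image_of_mem _ hv)⟩
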